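/- Conventions. Let $\Gamma(\mathbb{C}^n)$ be the boson Fock space over $\mathbb{C}^n$, and for $\mathbf v\in\mathbb{C}^n$ let $|\mathbf v\rangle = e^{-\frac12|\mathbf v|^2}\,\bigl(1\oplus \mathbf v\oplus \tfrac{\mathbf v^{\otimes 2}}{\sqrt{2!}}\oplus\cdots\bigr)$ be the coherent state at $\mathbf v$. The Weyl (displacement) unitary $W(\mathbf u)$ is given by $W(\mathbf u)|\mathbf v\rangle = e^{-i\,\mathrm{Im}(\mathbf u^\dagger \mathbf v)}|\mathbf u+\mathbf v\rangle$, and for an $n\times n$ unitary matrix $U$ the passive unitary $\Gamma(U)$ is given by $\Gamma(U)|\mathbf v\rangle=|U\mathbf v\rangle$, for all $\mathbf v\in\mathbb{C}^n$. A state is a positive operator $\rho$ on $\Gamma(\mathbb{C}^n)$ with $\operatorname{tr}\rho=1$. It is an $n$-mode Gaussian state with mean $\mathbf m\in\mathbb{C}^n$ and covariance operator $S$, where $S$ is a real linear operator on $\mathbb{C}^n$ that is symmetric for the real inner product $\mathrm{Re}(\mathbf u^\dagger \mathbf v)$, if $$\operatorname{tr}\bigl(\rho\, W(\mathbf z)\bigr)=\exp\bigl(-2i\,\mathrm{Im}(\mathbf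 z^\dagger \mathbf m)-\mathrm{Re}(\mathbf z^\dagger S\mathbf z)\bigr)\qquad\text{for all }\mathbf z\in\mathbb{C}^n.$$ Its covariance matrix $S_{\mathbb R}$ is the real $2n\times 2n$ matrix of $S$ in the basis $\mathbf e_1,\dots,\mathbf e_n,i\mathbf e_1,\dots,i\mathbf e_n$. For $0<s<\infty$ let $\gamma(s)=(1-e^{-s})e^{-s a^\dagger a}$ be the one-mode thermal state, and let $\gamma(\infty)=|0\rangle\langle 0|$. A displaced thermal state is an operator of the form $W(\mathbf u)\bigl(\gamma(s_1)\otimes\cdots\otimes\gamma(s_n)\bigr)W(\mathbf u)^\dagger$ with $\mathbf u\in\mathbb{C}^n$ and $0<s_1,\dots,s_n\le\infty$. Let $J=\begin{bmatrix}0&I_n\\-I_n&0\end{bmatrix}$. Theorem. Let $\rho$ be an $n$-mode Gaussian state with covariance matrix $S_{\mathbb R}$. Then there exists an $n\times n$ unitary matrix $U$ such that $\Gamma(U)\rho\,\Gamma(U)^\dagger$ is a displaced thermal state if and only if $S_{\mathbb R}J=JS_{\mathbb R}$. Moreover, $S_{\mathbb R}J=JS_{\mathbb R}$ if and only if there is an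 $n\times n$ complex matrix $X$ such that $X-\tfrac12 I_n$ is Hermitian positive semidefinite and $$S_{\mathbb R}=\begin{bmatrix}\mathrm{Re}\,X&-\mathrm{Im}\,X\\ \mathrm{Im}\,X&\mathrm{Re}\,X\end{bmatrix}.$$ -/

import Mathlib

open scoped ComplexConjugate ComplexOrder ENNReal InnerProductSpace Nat Topology

noncomputable section

namespace Bosonic

/-! ### The boson Fock space of `ℂⁿ` -/

/-- The phase space `ℂⁿ`; the inner product `inner ℂ u v` is `u† v`, conjugate linear in `u`. -/
abbrev PhaseSpace (n : ℕ) : Type := EuclideanSpace ℂ (Fin n)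

/-- The boson Fock space over `ℂⁿ` in its occupation-number form `ℓ²(ℕⁿ)`. The coordinate
`α = (α₁, …, αₙ)` belongs to the normalized number vector `|α₁⟩ ⊗ ⋯ ⊗ |αₙ⟩`, that is, to the
normalized symmetrization of `e₁^{⊗α₁} ⊗ ⋯ ⊗ eₙ^{⊗αₙ}` in the `(α₁ + ⋯ + αₙ)`-particle space. -/
abbrev Fock (n : ℕ) : Type := lp (fun _ : Fin n → ℕ => ℂ) 2

/-- The number vector `|α⟩`. -/
def numberVec {n : ℕ} (α : Fin n → ℕ) : Fock n := lp.single 2 α 1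

/-- The coordinate of `1 ⊕ u ⊕ u^{⊗2}/√2! ⊕ ⋯` along the number vector `|α⟩`. -/
def expCoeff {n : ℕ} (u : PhaseSpace n) (α : Fin n → ℕ) : ℂ :=
  ∏ j, u j ^ α j / (Real.sqrt ((α j)! : ℝ) : ℂ)

theorem summable_pi_prod {n : ℕ} (f : Fin n → ℕ → ℂ) (hf : ∀ j, Summable fun k => ‖f j k‖) :
    Summable fun α : Fin n → ℕ => ‖∏ j, f j (α j)‖ := by
  refine summable_of_sum_le (c := ∏ j, ∑' k, ‖f j k‖) (fun _ => norm_nonneg _) fun s => ?_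
  obtain ⟨N, hN⟩ : ∃ N : ℕ, ∀ α ∈ s, ∀ j, α j < N :=
    ⟨(s.sup fun α => ∑ j, α j) + 1, fun α hα j => Nat.lt_succ_of_le <|
      (Finset.single_le_sum (fun _ _ => Nat.zero_le _) (Finset.mem_univ j)).trans
        (Finset.le_sup (f := fun α : Fin n → ℕ => ∑ j, α j) hα)⟩
  calc ∑ α ∈ s, ‖∏ j, f j (α j)‖
      ≤ ∑ α ∈ Fintype.piFinset fun _ : Fin n => Finset.range N, ‖∏ j, f j (α j)‖ :=
        Finset.sum_le_sum_of_subset_of_nonneg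
          (fun α hα => by simpa using hN α hα) fun _ _ _ => norm_nonneg _
    _ = ∏ j, ∑ k ∈ Finset.range N, ‖f j k‖ := by
        rw [Finset.prod_univ_sum]; simp [norm_prod]
    _ ≤ ∏ j, ∑' k, ‖f j k‖ :=
        Finset.prod_le_prod (fun _ _ => Finset.sum_nonneg fun _ _ => norm_nonneg _)
          fun j _ => (hf j).sum_le_tsum _ fun _ _ => norm_nonneg _

theorem tendsto_piFinset_range (n : ℕ) :
    Filter.Tendsto (fun N : ℕ => Fintype.piFinset fun _ : Fin n => Finset.range N)
      Filter.atTop Filter.atTop := by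
  refine Filter.tendsto_atTop_finset_of_monotone ?_ fun α => ⟨(∑ j, α j) + 1, ?_⟩
  · intro a b hab
    exact Fintype.piFinset_subset _ _ fun _ => Finset.range_mono hab
  · simp only [Fintype.mem_piFinset, Finset.mem_range]
    exact fun j => Nat.lt_succ_of_le <|
      Finset.single_le_sum (fun _ _ => Nat.zero_le _) (Finset.mem_univ j)

theorem hasSum_pi_prod {n : ℕ} (f : Fin n → ℕ → ℂ) (hf : ∀ j, Summable fun k => ‖f j k‖) :
    HasSum (fun α : Fin n → ℕ => ∏ j, f j (α j)) (∏ j, ∑' k, f j k) := by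
  have h := (summable_pi_prod f hf).of_norm.hasSum
  have h1 := h.comp (tendsto_piFinset_range n)
  have h2 : Filter.Tendsto (fun N : ℕ => ∏ j, ∑ k ∈ Finset.range N, f j k) Filter.atTop
      (𝓝 (∏ j, ∑' k, f j k)) :=
    tendsto_finsetProd _ fun j _ => (hf j).of_norm.hasSum.tendsto_sum_nat
  have h3 : (fun N : ℕ => ∏ j, ∑ k ∈ Finset.range N, f j k) =
      ((fun s => ∑ b ∈ s, ∏ j, f j (b j)) ∘
        fun N : ℕ => Fintype.piFinset fun _ : Fin n => Finset.range N) := by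
    funext N; simp [Finset.prod_univ_sum]
  rw [h3] at h2
  rwa [tendsto_nhds_unique h1 h2] at h

theorem conj_expCoeff_mul {n : ℕ} (u v : PhaseSpace n) (α : Fin n → ℕ) :
    conj (expCoeff u α) * expCoeff v α = ∏ j, (conj (u j) * v j) ^ α j / ((α j)! : ℂ) := by
  simp only [expCoeff, map_prod, ← Finset.prod_mul_distrib]
  refine Finset.prod_congr rfl fun j _ => ?_
  have h : ((Real.sqrt ((α j)! : ℝ) : ℂ)) * (Real.sqrt ((α j)! : ℝ) : ℂ) = ((α j)! : ℂ) := by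
    rw [← Complex.ofReal_mul, Real.mul_self_sqrt (Nat.cast_nonneg _)]; simp
  rw [map_div₀, Complex.conj_ofReal, map_pow, div_mul_div_comm, h, mul_pow]

theorem summable_norm_expSeries (z : ℂ) : Summable fun k : ℕ => ‖z ^ k / (k ! : ℂ)‖ :=
  NormedSpace.norm_expSeries_div_summable z

theorem memℓp_expCoeff {n : ℕ} (u : PhaseSpace n) : Memℓp (expCoeff u) 2 := by
  refine memℓp_gen ?_
  have h := summable_pi_prod (fun j k => (conj (u j) * u j) ^ k / (k ! : ℂ))
    fun j => summable_norm_expSeries _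
  refine h.congr fun α => ?_
  rw [← conj_expCoeff_mul, norm_mul, RCLike.norm_conj]
  simp [sq]

/-- The exponential vector `|e(u)⟩`. -/
def expVec {n : ℕ} (u : PhaseSpace n) : Fock n := ⟨expCoeff u, memℓp_expCoeff u⟩

theorem inner_expVec {n : ℕ} (u v : PhaseSpace n) :
    inner ℂ (expVec u) (expVec v) = Complex.exp (inner ℂ u v) := by
  have h := hasSum_pi_prod (fun j k => (conj (u j) * v j) ^ k / (k ! : ℂ))
    fun j => summable_norm_expSeries _
  have h1 := lp.hasSum_inner (𝕜 := ℂ) (expVec u) (expVec v)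
  have h2 : (fun α : Fin n → ℕ => inner ℂ (expVec u α) (expVec v α)) =
      fun α => ∏ j, (conj (u j) * v j) ^ α j / ((α j)! : ℂ) := by
    funext α
    rw [← conj_expCoeff_mul, mul_comm]
    rfl
  rw [h2] at h1
  rw [h1.unique h, PiLp.inner_apply, Complex.exp_sum]
  refine Finset.prod_congr rfl fun j _ => ?_
  rw [Complex.exp_eq_exp_ℂ, NormedSpace.exp_eq_tsum_div]
  simp [mul_comm]

/-- The coherent state `|v⟩ = exp(-|v|²/2) |e(v)⟩`. -/
def coherent {n : ℕ} (v : PhaseSpace n) : Fock n :=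
  Complex.exp (-((‖v‖ ^ 2 / 2 : ℝ) : ℂ)) • expVec v

theorem eq_zero_of_power_sums {n : ℕ} (c : (Fin n → ℕ) → ℂ)
    (h : ∀ u : Fin n → ℂ, HasSum (fun α => c α * ∏ j, u j ^ α j) 0) : c = 0 := by
  classical
  have key : ∀ (u : Fin n → ℂ) (k : ℕ),
      ∑ α ∈ Finset.piAntidiag Finset.univ k, c α * ∏ j, u j ^ α j = 0 := by
    intro u
    set a : ℕ → ℂ := fun k =>
      ∑ α ∈ Finset.piAntidiag Finset.univ k, c α * ∏ j, u j ^ α j with ha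
    have hs : ∀ t : ℂ, HasSum (fun k => t ^ k * a k) 0 := by
      intro t
      have h1 := (h fun j => t * u j).tsum_fiberwise fun α => ∑ j, α j
      refine h1.congr_fun fun k => ?_
      have h2 : ((fun α : Fin n → ℕ => ∑ j, α j) ⁻¹' {k}) =
          ((Finset.piAntidiag Finset.univ k : Finset (Fin n → ℕ)) : Set (Fin n → ℕ)) := by
        ext α; simp
      rw [h2, Finset.tsum_subtype' _ fun α : Fin n → ℕ => c α * ∏ j, (t * u j) ^ α j,
        Finset.mul_sum]
      refine Finset.sum_congr rfl fun α hα => ?_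
      have hk : ∑ j, α j = k := by simpa using hα
      simp only [mul_pow, Finset.prod_mul_distrib, Finset.prod_pow_eq_pow_sum, hk]
      ring
    let p : FormalMultilinearSeries ℂ ℂ ℂ := fun k =>
      ContinuousMultilinearMap.mkPiRing ℂ (Fin k) (a k)
    have hp : HasFPowerSeriesAt (0 : ℂ → ℂ) p 0 := by
      rw [hasFPowerSeriesAt_iff]
      refine Filter.Eventually.of_forall fun z => ?_
      simpa [p, FormalMultilinearSeries.coeff] using hs z
    intro k
    have := congrArg (fun q : FormalMultilinearSeries ℂ ℂ ℂ => q.coeff k) hp.eq_zero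
    simpa [p, FormalMultilinearSeries.coeff] using this
  funext β
  have hP : (∑ α ∈ Finset.piAntidiag Finset.univ (∑ j, β j),
      MvPolynomial.monomial (Finsupp.equivFunOnFinite.symm α) (c α)) = 0 := by
    refine MvPolynomial.funext fun u => ?_
    rw [map_zero, map_sum, ← key u (∑ j, β j)]
    refine Finset.sum_congr rfl fun α _ => ?_
    rw [MvPolynomial.eval_monomial, Finsupp.prod_fintype _ _ (by simp)]
    simp
  have h3 := congrArg (MvPolynomial.coeff (Finsupp.equivFunOnFinite.symm β)) hP
  rw [MvPolynomial.coeff_sum, Finset.sum_eq_single β] at h3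
  · simpa using h3
  · intro α _ hne
    rw [MvPolynomial.coeff_monomial, if_neg]
    simpa using hne
  · intro hβ
    simp at hβ

/-- Exponential vectors are total in the Fock space. -/
theorem dense_span_expVec (n : ℕ) :
    Dense (Submodule.span ℂ (Set.range (expVec : PhaseSpace n → Fock n)) : Set (Fock n)) := by
  rw [Submodule.dense_iff_topologicalClosure_eq_top, Submodule.topologicalClosure_eq_top_iff,
    Submodule.eq_bot_iff]
  intro f hf
  have hf' : ∀ u : PhaseSpace n, inner ℂ (expVec u) f = 0 := fun u =>
    (Submodule.mem_orthogonal _ f).1 hf _ (Submodule.subset_span ⟨u, rfl⟩)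
  have h := eq_zero_of_power_sums
    (fun α => f α * ∏ j, ((Real.sqrt ((α j)! : ℝ) : ℂ))⁻¹) fun u => by
      have h1 := lp.hasSum_inner (𝕜 := ℂ) (expVec (WithLp.toLp 2 fun j => conj (u j))) f
      rw [hf'] at h1
      refine h1.congr_fun fun α => ?_
      have h2 : conj (expCoeff (WithLp.toLp 2 fun j => conj (u j) : PhaseSpace n) α) =
          (∏ j, u j ^ α j) * ∏ j, ((Real.sqrt ((α j)! : ℝ) : ℂ))⁻¹ := by
        rw [expCoeff, map_prod, ← Finset.prod_mul_distrib]
        refine Finset.prod_congr rfl fun j _ => ?_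
        rw [map_div₀, map_pow, Complex.conj_conj, Complex.conj_ofReal, div_eq_mul_inv]
      change _ = f α * conj (expCoeff _ α)
      rw [h2]
      ring
  ext α
  have hα := congrFun h α
  simp only [Pi.zero_apply, mul_eq_zero] at hα
  rcases hα with hα | hα
  · simpa using hα
  · exfalso
    rw [Finset.prod_eq_zero_iff] at hα
    obtain ⟨j, -, hj⟩ := hα
    rw [inv_eq_zero, Complex.ofReal_eq_zero, Real.sqrt_eq_zero (Nat.cast_nonneg _)] at hj
    exact Nat.factorial_ne_zero _ (by exact_mod_cast hj)

theorem dense_span_coherent (n : ℕ) :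
    Dense (Submodule.span ℂ (Set.range (coherent : PhaseSpace n → Fock n)) : Set (Fock n)) := by
  refine (dense_span_expVec n).mono ?_
  rw [SetLike.coe_subset_coe, Submodule.span_le]
  rintro _ ⟨v, rfl⟩
  have h : expVec v = Complex.exp (((‖v‖ ^ 2 / 2 : ℝ) : ℂ)) • coherent v := by
    rw [coherent, smul_smul, ← Complex.exp_add]; simp
  rw [h]
  exact Submodule.smul_mem _ _ (Submodule.subset_span ⟨v, rfl⟩)

/-! ### Weyl operators and passive unitaries -/

/-- The continuous linear operator with `|v⟩ ↦ ψ v` for every coherent state `|v⟩`; see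
`ofCoherent_coherent`. -/
def ofCoherent {n : ℕ} (ψ : PhaseSpace n → Fock n) : Fock n →L[ℂ] Fock n :=
  (Finsupp.linearCombination ℂ ψ).extendOfNorm (Finsupp.linearCombination ℂ coherent)

theorem inner_linearCombination {ι H : Type*} [NormedAddCommGroup H] [InnerProductSpace ℂ H]
    (f : ι → H) (x y : ι →₀ ℂ) :
    inner ℂ (Finsupp.linearCombination ℂ f x) (Finsupp.linearCombination ℂ f y) =
      ∑ j ∈ y.support, y j * ∑ i ∈ x.support, conj (x i) * inner ℂ (f i) (f j) := by
  simp only [Finsupp.linearCombination_apply, Finsupp.sum, sum_inner, inner_sum,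
    inner_smul_left, inner_smul_right]

theorem ofCoherent_coherent {n : ℕ} (ψ : PhaseSpace n → Fock n)
    (hψ : ∀ v w, inner ℂ (ψ v) (ψ w) = inner ℂ (coherent v) (coherent w)) (v : PhaseSpace n) :
    ofCoherent ψ (coherent v) = ψ v := by
  have hd : DenseRange (Finsupp.linearCombination ℂ (coherent : PhaseSpace n → Fock n)) := by
    have := dense_span_coherent n
    rwa [← Finsupp.range_linearCombination] at this
  have hn : ∀ x, ‖Finsupp.linearCombination ℂ ψ x‖ ≤
      1 * ‖Finsupp.linearCombination ℂ (coherent : PhaseSpace n → Fock n) x‖ := by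
    intro x
    rw [one_mul]
    refine le_of_eq ?_
    rw [@norm_eq_sqrt_re_inner ℂ, @norm_eq_sqrt_re_inner ℂ, inner_linearCombination,
      inner_linearCombination]
    simp only [hψ]
  have h := LinearMap.extendOfNorm_eq hd ⟨1, hn⟩ (Finsupp.single v 1)
  rwa [Finsupp.linearCombination_single, Finsupp.linearCombination_single, one_smul, one_smul]
    at h

theorem inner_coherent {n : ℕ} (v w : PhaseSpace n) :
    inner ℂ (coherent v) (coherent w) =
      Complex.exp (inner ℂ v w - ((‖v‖ ^ 2 / 2 : ℝ) : ℂ) - ((‖w‖ ^ 2 / 2 : ℝ) : ℂ)) := by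
  rw [coherent, coherent, inner_smul_left, inner_smul_right, inner_expVec, ← Complex.exp_conj,
    ← Complex.exp_add, ← Complex.exp_add, map_neg, Complex.conj_ofReal]
  congr 1
  ring

/-- The Weyl (displacement) operator: `W(u) |v⟩ = exp(-i Im (u† v)) |u + v⟩`. -/
def weyl {n : ℕ} (u : PhaseSpace n) : Fock n →L[ℂ] Fock n :=
  ofCoherent fun v => Complex.exp (-Complex.I * ((inner ℂ u v).im : ℂ)) • coherent (u + v)

theorem weyl_coherent {n : ℕ} (u v : PhaseSpace n) :
    weyl u (coherent v) =
      Complex.exp (-Complex.I * ((inner ℂ u v).im : ℂ)) • coherent (u + v) := by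
  refine ofCoherent_coherent _ (fun v w => ?_) v
  rw [inner_smul_left, inner_smul_right, inner_coherent, inner_coherent, ← Complex.exp_conj,
    ← Complex.exp_add, ← Complex.exp_add]
  congr 1
  have hv := @norm_add_sq ℂ _ _ _ _ u v
  have hw := @norm_add_sq ℂ _ _ _ _ u w
  rw [hv, hw, inner_add_left, inner_add_right, inner_add_right, inner_self_eq_norm_sq_to_K]
  have hc := inner_conj_symm (𝕜 := ℂ) v u
  have h1 : (inner ℂ v u).re = (inner ℂ u v).re := by rw [← hc, Complex.conj_re]
  have h2 : (inner ℂ v u).im = -(inner ℂ u v).im := by rw [← hc, Complex.conj_im]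
  apply Complex.ext
  · simp [← Complex.ofReal_pow, h1]
    ring
  · simp [← Complex.ofReal_pow, h2]

/-- The passive unitary `Γ(U)`: `Γ(U) |v⟩ = |U v⟩`. -/
def passive {n : ℕ} (U : Matrix.unitaryGroup (Fin n) ℂ) : Fock n →L[ℂ] Fock n :=
  ofCoherent fun v => coherent (Matrix.toEuclideanLin (U : Matrix (Fin n) (Fin n) ℂ) v)

theorem inner_unitary {n : ℕ} (U : Matrix.unitaryGroup (Fin n) ℂ) (v w : PhaseSpace n) :
    inner ℂ (Matrix.toEuclideanLin (U : Matrix (Fin n) (Fin n) ℂ) v)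
      (Matrix.toEuclideanLin (U : Matrix (Fin n) (Fin n) ℂ) w) = inner ℂ v w := by
  have hU : (U : Matrix (Fin n) (Fin n) ℂ).conjTranspose * (U : Matrix (Fin n) (Fin n) ℂ) = 1 :=
    Matrix.UnitaryGroup.star_mul_self U
  rw [← LinearMap.adjoint_inner_right, ← Matrix.toEuclideanLin_conjTranspose_eq_adjoint]
  congr 1
  ext1
  simp [Matrix.mulVec_mulVec, hU]

theorem passive_coherent {n : ℕ} (U : Matrix.unitaryGroup (Fin n) ℂ) (v : PhaseSpace n) :
    passive U (coherent v) =
      coherent (Matrix.toEuclideanLin (U : Matrix (Fin n) (Fin n) ℂ) v) := by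
  refine ofCoherent_coherent _ (fun v w => ?_) v
  have hn : ∀ v : PhaseSpace n,
      ‖Matrix.toEuclideanLin (U : Matrix (Fin n) (Fin n) ℂ) v‖ = ‖v‖ := fun v => by
    rw [@norm_eq_sqrt_re_inner ℂ, @norm_eq_sqrt_re_inner ℂ, inner_unitary]
  rw [inner_coherent, inner_coherent, inner_unitary, hn, hn]

theorem ext_coherent {n : ℕ} {A B : Fock n →L[ℂ] Fock n}
    (h : ∀ v, A (coherent v) = B (coherent v)) : A = B := by
  refine ContinuousLinearMap.ext_on (dense_span_coherent n) ?_
  rintro _ ⟨v, rfl⟩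
  exact h v

/-- `Γ(U) W(u) = W(U u) Γ(U)`. Together with `⟨0| Γ(U) |0⟩ = 1 > 0` this determines the unitary
operator `Γ(U)`. -/
theorem passive_comp_weyl {n : ℕ} (U : Matrix.unitaryGroup (Fin n) ℂ) (u : PhaseSpace n) :
    passive U ∘L weyl u =
      weyl (Matrix.toEuclideanLin (U : Matrix (Fin n) (Fin n) ℂ) u) ∘L passive U := by
  refine ext_coherent fun v => ?_
  simp only [ContinuousLinearMap.comp_apply, weyl_coherent, passive_coherent, map_smul, map_add,
    inner_unitary]

theorem inner_vacuum_passive {n : ℕ} (U : Matrix.unitaryGroup (Fin n) ℂ) :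
    inner ℂ (coherent 0) (passive U (coherent 0)) = 1 := by
  rw [passive_coherent, map_zero, inner_coherent]
  simp

/-! ### States and Gaussian states -/

/-- The trace `∑_α ⟨α| T |α⟩` of a (trace-class) operator, in the number basis. -/
def trace {n : ℕ} (T : Fock n →L[ℂ] Fock n) : ℂ :=
  ∑' α : Fin n → ℕ, inner ℂ (numberVec α) (T (numberVec α))

/-- A state (density operator): positive, trace class, of trace one. For a positive operator,
trace class means that the diagonal series in an orthonormal basis converges. -/
def IsState {n : ℕ} (ρ : Fock n →L[ℂ] Fock n) : Prop :=
  ρ.IsPositive ∧ HasSum (fun α : Fin n → ℕ => inner ℂ (numberVec α) (ρ (numberVec α))) 1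

/-- The quantum characteristic function `z ↦ tr (ρ W(z))`. -/
def charFn {n : ℕ} (ρ : Fock n →L[ℂ] Fock n) (z : PhaseSpace n) : ℂ := trace (ρ ∘L weyl z)

/-- `ρ` is the Gaussian state with mean annihilation vector `m` and covariance operator `S`, a
real linear operator on `ℂⁿ` that is symmetric for the real inner product `Re (u† v)`. -/
structure IsGaussian {n : ℕ} (ρ : Fock n →L[ℂ] Fock n) (m : PhaseSpace n)
    (S : PhaseSpace n →ₗ[ℝ] PhaseSpace n) : Prop where
  isState : IsState ρ
  symmetric : ∀ u v : PhaseSpace n, (inner ℂ u (S v)).re = (inner ℂ (S u) v).re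
  charFn_eq : ∀ z : PhaseSpace n, charFn ρ z =
    Complex.exp (-2 * Complex.I * ((inner ℂ z m).im : ℂ) - ((inner ℂ z (S z)).re : ℂ))

/-- The matrix of a real linear operator on `ℂⁿ` in the real basis `e₁, …, eₙ, i e₁, …, i eₙ`. -/
def realMatrix {n : ℕ} (S : PhaseSpace n →ₗ[ℝ] PhaseSpace n) :
    Matrix (Fin n ⊕ Fin n) (Fin n ⊕ Fin n) ℝ :=
  Matrix.fromBlocks
    (Matrix.of fun i j => (S (EuclideanSpace.single j 1) i).re)
    (Matrix.of fun i j => (S (EuclideanSpace.single j Complex.I) i).re)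
    (Matrix.of fun i j => (S (EuclideanSpace.single j 1) i).im)
    (Matrix.of fun i j => (S (EuclideanSpace.single j Complex.I) i).im)

/-- The standard symplectic matrix `[[0, I], [-I, 0]]`. -/
def stdJ (n : ℕ) : Matrix (Fin n ⊕ Fin n) (Fin n ⊕ Fin n) ℝ := Matrix.fromBlocks 0 1 (-1) 0

/-! ### Thermal states -/

/-- The Boltzmann factor `e^{-s}` of an inverse temperature `s`, equal to `0` for `s = ∞`. -/
def boltzmann (s : ℝ≥0∞) : ℝ := if s = ∞ then 0 else Real.exp (-s.toReal)

/-- The eigenvalue `(1 - e^{-s}) e^{-s k}` of the one-mode thermal state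
`γ(s) = (1 - e^{-s}) e^{-s a†a}` at `|k⟩`, where `a†a |k⟩ = k |k⟩`. For `s = ∞` it is `1` at
`k = 0` and `0` elsewhere, so that `γ(∞)` is the vacuum state. -/
def thermalWeight (s : ℝ≥0∞) (k : ℕ) : ℝ := (1 - boltzmann s) * boltzmann s ^ k

theorem boltzmann_nonneg (s : ℝ≥0∞) : 0 ≤ boltzmann s := by
  unfold boltzmann; split_ifs <;> positivity

theorem boltzmann_le_one (s : ℝ≥0∞) : boltzmann s ≤ 1 := by
  unfold boltzmann
  split_ifs
  · exact zero_le_one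
  · exact Real.exp_le_one_iff.2 (neg_nonpos.2 ENNReal.toReal_nonneg)

theorem thermalWeight_nonneg (s : ℝ≥0∞) (k : ℕ) : 0 ≤ thermalWeight s k :=
  mul_nonneg (sub_nonneg.2 (boltzmann_le_one s)) (pow_nonneg (boltzmann_nonneg s) k)

theorem thermalWeight_le_one (s : ℝ≥0∞) (k : ℕ) : thermalWeight s k ≤ 1 :=
  mul_le_one₀ (sub_le_self _ (boltzmann_nonneg s)) (pow_nonneg (boltzmann_nonneg s) k)
    (pow_le_one₀ (boltzmann_nonneg s) (boltzmann_le_one s))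

theorem norm_prod_thermalWeight_le {n : ℕ} (s : Fin n → ℝ≥0∞) (α : Fin n → ℕ) :
    ‖((∏ j, thermalWeight (s j) (α j) : ℝ) : ℂ) • ContinuousLinearMap.id ℂ ℂ‖ ≤ 1 := by
  rw [norm_smul, ContinuousLinearMap.norm_id, mul_one, Complex.norm_real, Real.norm_eq_abs,
    abs_of_nonneg (Finset.prod_nonneg fun j _ => thermalWeight_nonneg _ _)]
  exact Finset.prod_le_one (fun j _ => thermalWeight_nonneg _ _)
    fun j _ => thermalWeight_le_one _ _

/-- The `n`-mode thermal state `γ(s₁) ⊗ ⋯ ⊗ γ(sₙ)`: the operator that is diagonal in the number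
basis and multiplies `|α⟩ = |α₁⟩ ⊗ ⋯ ⊗ |αₙ⟩` by the product of the one-mode eigenvalues. -/
def thermal {n : ℕ} (s : Fin n → ℝ≥0∞) : Fock n →L[ℂ] Fock n :=
  lp.mapCLM 2 (fun α : Fin n → ℕ =>
      ((∏ j, thermalWeight (s j) (α j) : ℝ) : ℂ) • ContinuousLinearMap.id ℂ ℂ)
    zero_le_one (norm_prod_thermalWeight_le s)

/-- Displaced thermal states: `W(u) γ(s) W(u)†` with `u ∈ ℂⁿ` and `0 < s₁, …, sₙ ≤ ∞`. -/
def IsDisplacedThermal {n : ℕ} (ρ : Fock n →L[ℂ] Fock n) : Prop :=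
  ∃ (u : PhaseSpace n) (s : Fin n → ℝ≥0∞), (∀ j, 0 < s j) ∧
    ρ = weyl u ∘L thermal s ∘L (weyl u).adjoint

end Bosonic

end

noncomputable section

namespace Bosonic

open MeasureTheory

variable {n : ℕ}

/-! ### Weyl operators and passive unitaries on exponential vectors -/

/-! Commuting with `J` means that `S` commutes with multiplication by `i`, that is, `S` is given by
a complex matrix `X` (`realMatrix_commute_iff`). Both equivalences pass through this.

Suppose a rotated copy of `ρ` is displaced thermal. Thermal states are invariant under `Γ(i)`, while
displacements only multiply characteristic functions by phases. Hence `|tr (ρ W(z))| = exp(-Re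
z†Sz)` is unchanged under `z ↦ iz`, and polarization makes `S` complex linear
(`IsGaussian.map_smul_I`).

Conversely, if `S` is given by `X`, symmetry makes `X` Hermitian. Diagonalizing `X` by a unitary and
removing the mean by a displacement leaves a state with characteristic function `exp(-∑ dⱼ|zⱼ|²)`.
Its matrix elements between exponential vectors are recovered by the Fourier–Weyl inversion
`IsState.integral_weylKernel_mul_charFn`, a Gaussian integral: they are products of `(1 - qⱼ) exp(qⱼ
w̄ⱼvⱼ)` with `qⱼ = 1 - 1/(dⱼ + 1/2)`. Positivity of the state forces `qⱼ ≥ 0`, so `dⱼ ≥ 1/2`, which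
is `X - 1/2 ≥ 0` (`IsState.half_le_of_charFn`). The same formula gives the matrix elements of the
thermal state with Boltzmann factors `qⱼ`, and exponential vectors are total, so the two states
coincide (`IsGaussian.diagonalization`).

Traces are handled by writing `ρ = K K†` with `K` Hilbert–Schmidt, which turns cyclicity into an
interchange of absolutely convergent sums. -/

theorem expVec_eq_smul_coherent (v : PhaseSpace n) :
    expVec v = Complex.exp (((‖v‖ ^ 2 / 2 : ℝ) : ℂ)) • coherent v := by
  rw [coherent, smul_smul, ← Complex.exp_add]; simp

theorem ext_expVec {A B : Fock n →L[ℂ] Fock n} (h : ∀ v, A (expVec v) = B (expVec v)) :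
    A = B :=
  ext_coherent fun v => by rw [coherent, map_smul, map_smul, h]

theorem ext_inner_expVec {x y : Fock n}
    (h : ∀ w, inner ℂ (expVec w) x = inner ℂ (expVec w) y) : x = y := by
  rw [← sub_eq_zero]
  refine Dense.eq_zero_of_inner_right (𝕜 := ℂ) (dense_span_expVec n) fun v hv => ?_
  induction hv using Submodule.span_induction with
  | mem x hx => obtain ⟨w, rfl⟩ := hx; rw [inner_sub_right, h, sub_self]
  | zero => simp
  | add x y _ _ hx hy => rw [inner_add_left, hx, hy, add_zero]
  | smul a x _ hx => rw [inner_smul_left, hx, mul_zero]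

theorem ext_inner_expVec_expVec {A B : Fock n →L[ℂ] Fock n}
    (h : ∀ w v, inner ℂ (expVec w) (A (expVec v)) = inner ℂ (expVec w) (B (expVec v))) :
    A = B :=
  ext_expVec fun v => ext_inner_expVec fun w => h w v

theorem weyl_expVec (u v : PhaseSpace n) :
    weyl u (expVec v) =
      Complex.exp (-((‖u‖ ^ 2 / 2 : ℝ) : ℂ) - inner ℂ u v) • expVec (u + v) := by
  rw [expVec_eq_smul_coherent, map_smul, weyl_coherent, coherent, smul_smul, smul_smul,
    ← Complex.exp_add, ← Complex.exp_add]
  congr 2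
  rw [@norm_add_sq ℂ _ _ _ _ u v]
  apply Complex.ext
  · simp
    ring
  · simp only [Complex.mul_im, Complex.add_im, Complex.sub_im, Complex.neg_im, Complex.neg_re,
      Complex.I_re, Complex.I_im, Complex.ofReal_im, Complex.ofReal_re]
    ring

theorem passive_expVec (U : Matrix.unitaryGroup (Fin n) ℂ) (v : PhaseSpace n) :
    passive U (expVec v) =
      expVec (Matrix.toEuclideanLin (U : Matrix (Fin n) (Fin n) ℂ) v) := by
  have hn : ‖Matrix.toEuclideanLin (U : Matrix (Fin n) (Fin n) ℂ) v‖ = ‖v‖ := by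
    rw [@norm_eq_sqrt_re_inner ℂ, @norm_eq_sqrt_re_inner ℂ, inner_unitary]
  rw [expVec_eq_smul_coherent, map_smul, passive_coherent, expVec_eq_smul_coherent, hn]

theorem weyl_zero : weyl (0 : PhaseSpace n) = ContinuousLinearMap.id ℂ (Fock n) :=
  ext_expVec fun v => by simp [weyl_expVec]

theorem adjoint_weyl (u : PhaseSpace n) : (weyl u).adjoint = weyl (-u) := by
  refine ext_inner_expVec_expVec fun w v => ?_
  rw [ContinuousLinearMap.adjoint_inner_right, weyl_expVec, weyl_expVec, inner_smul_left,
    inner_smul_right, inner_expVec, inner_expVec, ← Complex.exp_conj, ← Complex.exp_add,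
    ← Complex.exp_add]
  congr 1
  rw [map_sub, map_neg, Complex.conj_ofReal, inner_conj_symm, norm_neg, inner_add_left,
    inner_add_right, inner_neg_left, inner_neg_right]
  ring

theorem weyl_comp_weyl (u v : PhaseSpace n) :
    weyl u ∘L weyl v =
      Complex.exp (-Complex.I * ((inner ℂ u v).im : ℂ)) • weyl (u + v) := by
  refine ext_expVec fun w => ?_
  rw [ContinuousLinearMap.comp_apply, smul_apply, weyl_expVec, map_smul,
    weyl_expVec, weyl_expVec, smul_smul, smul_smul, ← Complex.exp_add, ← Complex.exp_add,
    add_assoc]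
  congr 2
  rw [@norm_add_sq ℂ _ _ _ _ u v, inner_add_left, inner_add_right]
  apply Complex.ext
  · simp
    ring
  · simp
    ring

theorem adjoint_weyl_comp_weyl (u : PhaseSpace n) :
    (weyl u).adjoint ∘L weyl u = ContinuousLinearMap.id ℂ (Fock n) := by
  have h : (inner ℂ u u : ℂ).im = 0 := inner_self_im (𝕜 := ℂ) u
  rw [adjoint_weyl, weyl_comp_weyl, neg_add_cancel, weyl_zero]
  simp only [inner_neg_left, Complex.neg_im, h, neg_zero, Complex.ofReal_zero,
    mul_zero, Complex.exp_zero, one_smul]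

theorem weyl_comp_adjoint_weyl (u : PhaseSpace n) :
    weyl u ∘L (weyl u).adjoint = ContinuousLinearMap.id ℂ (Fock n) := by
  have h : (inner ℂ u u : ℂ).im = 0 := inner_self_im (𝕜 := ℂ) u
  rw [adjoint_weyl, weyl_comp_weyl, add_neg_cancel, weyl_zero]
  simp only [inner_neg_right, Complex.neg_im, h, neg_zero, Complex.ofReal_zero,
    mul_zero, Complex.exp_zero, one_smul]

theorem norm_weyl_apply (u : PhaseSpace n) (x : Fock n) : ‖weyl u x‖ = ‖x‖ :=
  (ContinuousLinearMap.norm_map_iff_adjoint_comp_self (weyl u)).2 (adjoint_weyl_comp_weyl u) x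

/-- The canonical commutation relations: this phase is how a displacement enters the characteristic
function. -/
theorem adjoint_weyl_comp_weyl_comp_weyl (u z : PhaseSpace n) :
    (weyl u).adjoint ∘L weyl z ∘L weyl u =
      Complex.exp (-2 * Complex.I * ((inner ℂ z u).im : ℂ)) • weyl z := by
  have h : (inner ℂ u z : ℂ).im = -(inner ℂ z u : ℂ).im := by
    rw [← inner_conj_symm, Complex.conj_im]
  have h1 : (inner ℂ u u : ℂ).im = 0 := inner_self_im (𝕜 := ℂ) u
  rw [adjoint_weyl, weyl_comp_weyl, ContinuousLinearMap.comp_smul, weyl_comp_weyl, smul_smul,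
    ← Complex.exp_add]
  congr 2
  · rw [inner_add_right, inner_neg_left, inner_neg_left, Complex.add_im, Complex.neg_im,
      Complex.neg_im, h, h1]
    push_cast
    ring
  · abel

theorem adjoint_passive (U : Matrix.unitaryGroup (Fin n) ℂ) :
    (passive U).adjoint = passive U⁻¹ := by
  refine ext_inner_expVec_expVec fun w v => ?_
  rw [ContinuousLinearMap.adjoint_inner_right, passive_expVec, passive_expVec,
    inner_expVec, inner_expVec, ← inner_unitary U w]
  congr 2
  ext1
  simp [Matrix.mulVec_mulVec]

theorem passive_comp_passive (U V : Matrix.unitaryGroup (Fin n) ℂ) :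
    passive U ∘L passive V = passive (U * V) := by
  refine ext_expVec fun v => ?_
  rw [ContinuousLinearMap.comp_apply, passive_expVec, passive_expVec, passive_expVec]
  congr 1
  ext1
  simp [Matrix.mulVec_mulVec]

theorem passive_one : passive (1 : Matrix.unitaryGroup (Fin n) ℂ) =
    ContinuousLinearMap.id ℂ (Fock n) :=
  ext_expVec fun v => by rw [passive_expVec]; congr 1; ext1; simp

theorem adjoint_passive_comp_passive (U : Matrix.unitaryGroup (Fin n) ℂ) :
    (passive U).adjoint ∘L passive U = ContinuousLinearMap.id ℂ (Fock n) := by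
  rw [adjoint_passive, passive_comp_passive, inv_mul_cancel, passive_one]

theorem adjoint_passive_comp_weyl_comp_passive (U : Matrix.unitaryGroup (Fin n) ℂ)
    (z : PhaseSpace n) : (passive U).adjoint ∘L weyl z ∘L passive U =
      weyl (Matrix.toEuclideanLin ((U⁻¹ : Matrix.unitaryGroup (Fin n) ℂ) :
        Matrix (Fin n) (Fin n) ℂ) z) := by
  rw [← ContinuousLinearMap.comp_assoc, adjoint_passive, passive_comp_weyl,
    ContinuousLinearMap.comp_assoc, passive_comp_passive, inv_mul_cancel, passive_one,
    ContinuousLinearMap.comp_id]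

/-- The distance between exponential vectors is a continuous expression in the kernel `exp ⟨w, v⟩`.
-/
theorem continuous_expVec : Continuous (expVec : PhaseSpace n → Fock n) := by
  rw [continuous_iff_continuousAt]
  intro v
  rw [ContinuousAt, tendsto_iff_norm_sub_tendsto_zero]
  have h : ∀ w : PhaseSpace n, ‖expVec w - expVec v‖ = √(Complex.exp (inner ℂ w w) -
      Complex.exp (inner ℂ w v) - Complex.exp (inner ℂ v w) +
        Complex.exp (inner ℂ v v)).re := by
    intro w
    rw [@norm_eq_sqrt_re_inner ℂ, inner_sub_left, inner_sub_right, inner_sub_right,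
      inner_expVec, inner_expVec, inner_expVec, inner_expVec, RCLike.re_to_complex]
    congr 2
    abel
  have hc : Continuous fun w : PhaseSpace n => √(Complex.exp (inner ℂ w w) -
      Complex.exp (inner ℂ w v) - Complex.exp (inner ℂ v w) +
        Complex.exp (inner ℂ v v)).re := by
    refine Real.continuous_sqrt.comp (Complex.continuous_re.comp ?_)
    fun_prop
  have h2 := hc.tendsto v
  simp only [sub_self, zero_sub, neg_add_cancel, Complex.zero_re, Real.sqrt_zero] at h2
  exact h2.congr fun w => (h w).symm

/-- Strong continuity, which supplies the measurability needed for integrals of `W(z) x`. -/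
theorem continuous_weyl_apply (x : Fock n) : Continuous fun z : PhaseSpace n => weyl z x := by
  have hd := dense_span_expVec n
  refine hd.induction (P := fun x => Continuous fun z : PhaseSpace n => weyl z x) ?_ ?_ x
  · intro y hy
    induction hy using Submodule.span_induction with
    | mem x hx =>
      obtain ⟨v, rfl⟩ := hx
      simp only [weyl_expVec]
      have := continuous_expVec (n := n)
      fun_prop
    | zero => simp only [map_zero]; exact continuous_const
    | add x y _ _ hx hy => simp only [map_add]; exact hx.add hy
    | smul a x _ hx => simp only [map_smul]; exact hx.const_smul a
  -- Weyl operators are isometries, so approximating the vector approximates the orbit map uniformly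
  -- in `z`.
  · refine isClosed_of_closure_subset fun y hy => ?_
    rw [Metric.mem_closure_iff] at hy
    refine continuous_of_uniform_approx_of_continuous fun s hs => ?_
    obtain ⟨ε, hε, h⟩ := Metric.mem_uniformity_dist.1 hs
    obtain ⟨x, hx, hxy⟩ := hy ε hε
    refine ⟨_, hx, fun z => h ?_⟩
    rwa [dist_eq_norm, ← map_sub, norm_weyl_apply, ← dist_eq_norm]

/-! ### Traces of operators with a Hilbert–Schmidt factor -/

/-- The number vectors as a Hilbert basis. -/
def numberBasis (n : ℕ) : HilbertBasis (Fin n → ℕ) ℂ (Fock n) :=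
  HilbertBasis.ofRepr (LinearIsometryEquiv.refl ℂ (Fock n))

theorem numberBasis_apply (α : Fin n → ℕ) : numberBasis n α = numberVec α := by
  rw [← (numberBasis n).repr_symm_single]
  rfl

section Hilbert

variable {ι H : Type*} [NormedAddCommGroup H] [InnerProductSpace ℂ H]

theorem inner_self_eq_ofReal (x : H) : inner ℂ x x = ((‖x‖ ^ 2 : ℝ) : ℂ) := by
  rw [inner_self_eq_norm_sq_to_K]
  simp

theorem hasSum_norm_sq_inner (b : HilbertBasis ι ℂ H) (x : H) :
    HasSum (fun i => ‖inner ℂ x (b i)‖ ^ 2) (‖x‖ ^ 2) := by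
  have h := b.hasSum_inner_mul_inner x x
  rw [inner_self_eq_ofReal] at h
  rw [← Complex.hasSum_ofReal]
  refine h.congr_fun fun i => ?_
  rw [← inner_conj_symm x (b i), Complex.conj_mul', norm_inner_symm]
  simp

theorem summable_norm_sq_comp (b : HilbertBasis ι ℂ H) {K : H →L[ℂ] H}
    (hK : Summable fun i => ‖K (b i)‖ ^ 2) (A : H →L[ℂ] H) :
    Summable fun i => ‖A (K (b i))‖ ^ 2 := by
  refine Summable.of_nonneg_of_le (fun _ => sq_nonneg _) (fun α => ?_)
    (Summable.mul_left (‖A‖ ^ 2) hK)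
  rw [← mul_pow]
  exact pow_le_pow_left₀ (norm_nonneg _) (A.le_opNorm _) 2

theorem summable_norm_sq_entries (b : HilbertBasis ι ℂ H) {f : ι → H}
    (hf : Summable fun i => ‖f i‖ ^ 2) :
    Summable fun p : ι × ι => ‖inner ℂ (f p.1) (b p.2)‖ ^ 2 := by
  rw [summable_prod_of_nonneg fun _ => sq_nonneg _]
  refine ⟨fun i => (hasSum_norm_sq_inner b (f i)).summable, ?_⟩
  simpa only [(hasSum_norm_sq_inner b _).tsum_eq] using hf

variable [CompleteSpace H]

/-- Cyclicity of the trace. Expanding in the basis gives a double series: summing over either index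
first yields one of the two sides, and the Hilbert–Schmidt property makes it absolutely convergent.
-/
theorem hasSum_trace_factor (b : HilbertBasis ι ℂ H) {K : H →L[ℂ] H}
    (hK : Summable fun i => ‖K (b i)‖ ^ 2) (A : H →L[ℂ] H) :
    HasSum (fun i => inner ℂ (b i) (K (K.adjoint (A (b i)))))
      (∑' i, inner ℂ (K (b i)) (A (K (b i)))) := by
  set F : ι × ι → ℂ := fun p =>
    inner ℂ (A.adjoint (K (b p.1))) (b p.2) * inner ℂ (b p.2) (K (b p.1)) with hF
  have hs : Summable F := by
    -- Each term is at most the sum of two squared matrix entries, since `xy ≤ x² + y²`.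
    refine Summable.of_norm_bounded ((summable_norm_sq_entries b
      (summable_norm_sq_comp b hK A.adjoint)).add (summable_norm_sq_entries b hK)) fun p => ?_
    rw [hF, norm_mul, norm_inner_symm (b p.2)]
    nlinarith [norm_nonneg (inner ℂ (A.adjoint (K (b p.1))) (b p.2)),
      norm_nonneg (inner ℂ (K (b p.1)) (b p.2)),
      two_mul_le_add_sq ‖(inner ℂ (A.adjoint (K (b p.1))) (b p.2) : ℂ)‖
        ‖(inner ℂ (K (b p.1)) (b p.2) : ℂ)‖]
  have h1 : HasSum (fun i => inner ℂ (K (b i)) (A (K (b i)))) (∑' p, F p) := by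
    refine hs.hasSum.prod_fiberwise fun i => ?_
    rw [← ContinuousLinearMap.adjoint_inner_left]
    exact b.hasSum_inner_mul_inner (A.adjoint (K (b i))) (K (b i))
  rw [h1.tsum_eq, ← (Equiv.prodComm ι ι).tsum_eq]
  refine hs.prod_symm.hasSum.prod_fiberwise fun i => ?_
  rw [← ContinuousLinearMap.adjoint_inner_left]
  refine (b.hasSum_inner_mul_inner _ _).congr_fun fun j => ?_
  change inner ℂ (A.adjoint (K (b j))) (b i) * inner ℂ (b i) (K (b j)) = _
  rw [ContinuousLinearMap.adjoint_inner_left, ContinuousLinearMap.adjoint_inner_left,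
    ContinuousLinearMap.adjoint_inner_right, mul_comm]

theorem exists_sqrt_of_isPositive {T : H →L[ℂ] H} (hT : T.IsPositive) :
    ∃ K : H →L[ℂ] H, K.adjoint = K ∧ T = K ∘L K.adjoint := by
  have h0 : 0 ≤ T := (ContinuousLinearMap.nonneg_iff_isPositive T).2 hT
  have h1 : (CFC.sqrt T).adjoint = CFC.sqrt T :=
    IsSelfAdjoint.of_nonneg (CFC.sqrt_nonneg T)
  refine ⟨CFC.sqrt T, h1, ?_⟩
  rw [h1]
  exact (CFC.sqrt_mul_sqrt_self T h0).symm

end Hilbert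

/-- The Hilbert–Schmidt property, tested on the number basis. -/
def IsHilbertSchmidt (K : Fock n →L[ℂ] Fock n) : Prop :=
  Summable fun α => ‖K (numberVec α)‖ ^ 2

theorem IsHilbertSchmidt.comp_left {K : Fock n →L[ℂ] Fock n} (hK : IsHilbertSchmidt K)
    (A : Fock n →L[ℂ] Fock n) : IsHilbertSchmidt (A ∘L K) := by
  simp only [IsHilbertSchmidt, ← numberBasis_apply] at hK ⊢
  exact summable_norm_sq_comp (numberBasis n) hK A

theorem IsHilbertSchmidt.hasSum_trace {K : Fock n →L[ℂ] Fock n} (hK : IsHilbertSchmidt K)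
    (A : Fock n →L[ℂ] Fock n) :
    HasSum (fun α => inner ℂ (numberVec α) ((K ∘L K.adjoint) (A (numberVec α))))
      (∑' β, inner ℂ (K (numberVec β)) (A (K (numberVec β)))) := by
  simp only [IsHilbertSchmidt, ← numberBasis_apply] at hK ⊢
  exact hasSum_trace_factor (numberBasis n) hK A

/-- `K` is the positive square root of `ρ`; the diagonal entries of `ρ` are then `‖K|α⟩‖²`, so
summability of the trace says that `K` is Hilbert–Schmidt. -/
theorem IsState.exists_factor {ρ : Fock n →L[ℂ] Fock n} (h : IsState ρ) :
    ∃ K : Fock n →L[ℂ] Fock n, IsHilbertSchmidt K ∧ ρ = K ∘L K.adjoint := by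
  obtain ⟨K, hK, hρ⟩ := exists_sqrt_of_isPositive h.1
  have h3 : ∀ α : Fin n → ℕ, inner ℂ (numberVec α) (ρ (numberVec α)) =
      ((‖K (numberVec α)‖ ^ 2 : ℝ) : ℂ) := fun α => by
    rw [hρ, ContinuousLinearMap.comp_apply, ← ContinuousLinearMap.adjoint_inner_left,
      hK, inner_self_eq_ofReal]
  have h4 := h.2.summable
  simp only [h3, Complex.summable_ofReal] at h4
  exact ⟨K, h4, hρ⟩

theorem IsHilbertSchmidt.trace_comp {K : Fock n →L[ℂ] Fock n} (hK : IsHilbertSchmidt K)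
    (A : Fock n →L[ℂ] Fock n) : trace ((K ∘L K.adjoint) ∘L A) =
      ∑' β, inner ℂ (K (numberVec β)) (A (K (numberVec β))) :=
  (hK.hasSum_trace A).tsum_eq

theorem IsState.trace_eq_one {ρ : Fock n →L[ℂ] Fock n} (h : IsState ρ) : trace ρ = 1 :=
  h.2.tsum_eq

theorem conj_factor (V K : Fock n →L[ℂ] Fock n) :
    V ∘L (K ∘L K.adjoint) ∘L V.adjoint = (V ∘L K) ∘L (V ∘L K).adjoint := by
  rw [ContinuousLinearMap.adjoint_comp]
  simp only [ContinuousLinearMap.comp_assoc]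

theorem IsState.trace_conj_comp {ρ : Fock n →L[ℂ] Fock n} (h : IsState ρ)
    (V A : Fock n →L[ℂ] Fock n) :
    trace ((V ∘L ρ ∘L V.adjoint) ∘L A) = trace (ρ ∘L (V.adjoint ∘L A ∘L V)) := by
  obtain ⟨K, hK, rfl⟩ := h.exists_factor
  rw [conj_factor, (hK.comp_left V).trace_comp, hK.trace_comp]
  simp only [ContinuousLinearMap.comp_apply, ContinuousLinearMap.adjoint_inner_right]

theorem IsState.conj {ρ : Fock n →L[ℂ] Fock n} (h : IsState ρ) {V : Fock n →L[ℂ] Fock n}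
    (hV : V.adjoint ∘L V = ContinuousLinearMap.id ℂ (Fock n)) :
    IsState (V ∘L ρ ∘L V.adjoint) := by
  refine ⟨h.1.conj_adjoint V, ?_⟩
  obtain ⟨K, hK, hρ⟩ := h.exists_factor
  have h1 := (hK.comp_left V).hasSum_trace (ContinuousLinearMap.id ℂ (Fock n))
  have h2 := h.trace_conj_comp V (ContinuousLinearMap.id ℂ (Fock n))
  rw [ContinuousLinearMap.id_comp, hV, ContinuousLinearMap.comp_id,
    ContinuousLinearMap.comp_id, h.trace_eq_one] at h2
  rw [← (hK.comp_left V).trace_comp, ← conj_factor, ← hρ, ContinuousLinearMap.comp_id, h2] at h1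
  exact h1

theorem IsState.charFn_conj_passive {ρ : Fock n →L[ℂ] Fock n} (h : IsState ρ)
    (U : Matrix.unitaryGroup (Fin n) ℂ) (z : PhaseSpace n) :
    charFn (passive U ∘L ρ ∘L (passive U).adjoint) z =
      charFn ρ (Matrix.toEuclideanLin ((U⁻¹ : Matrix.unitaryGroup (Fin n) ℂ) :
        Matrix (Fin n) (Fin n) ℂ) z) := by
  rw [charFn, h.trace_conj_comp, adjoint_passive_comp_weyl_comp_passive, charFn]

theorem trace_smul (c : ℂ) (T : Fock n →L[ℂ] Fock n) : trace (c • T) = c * trace T := by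
  simp only [trace, smul_apply, inner_smul_right, tsum_mul_left]

theorem IsState.charFn_conj_weyl {ρ : Fock n →L[ℂ] Fock n} (h : IsState ρ)
    (u z : PhaseSpace n) :
    charFn (weyl u ∘L ρ ∘L (weyl u).adjoint) z =
      Complex.exp (-2 * Complex.I * ((inner ℂ z u).im : ℂ)) * charFn ρ z := by
  rw [charFn, h.trace_conj_comp, adjoint_weyl_comp_weyl_comp_weyl, ContinuousLinearMap.comp_smul,
    trace_smul, charFn]

theorem IsState.norm_charFn_le_one {ρ : Fock n →L[ℂ] Fock n} (h : IsState ρ)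
    (z : PhaseSpace n) : ‖charFn ρ z‖ ≤ 1 := by
  have h1 := h.trace_eq_one
  obtain ⟨K, hK, rfl⟩ := h.exists_factor
  have h2 := hK.trace_comp (ContinuousLinearMap.id ℂ (Fock n))
  rw [ContinuousLinearMap.comp_id, h1] at h2
  simp only [ContinuousLinearMap.id_apply, inner_self_eq_ofReal] at h2
  have h3 : ∑' β, ‖K (numberVec β)‖ ^ 2 = 1 := by
    rw [← Complex.ofReal_tsum] at h2
    exact_mod_cast h2.symm
  rw [charFn, hK.trace_comp, ← h3]
  -- By Cauchy–Schwarz and isometry, each term is at most `‖K|β⟩‖²`, and these sum to the trace of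
  -- the state.
  refine tsum_of_norm_bounded (Summable.hasSum hK) fun β => ?_
  refine (norm_inner_le_norm _ _).trans_eq ?_
  rw [norm_weyl_apply, sq]

/-! ### Gaussian integrals over phase space -/

/-- The point `x + i y` of `ℂⁿ` with real coordinates `(x, y)`. -/
def ofReals (x : Fin n ⊕ Fin n → ℝ) : PhaseSpace n :=
  WithLp.toLp 2 fun j => (x (Sum.inl j) : ℂ) + Complex.I * (x (Sum.inr j) : ℂ)

theorem continuous_ofReals : Continuous (ofReals : (Fin n ⊕ Fin n → ℝ) → PhaseSpace n) := by
  unfold ofReals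
  fun_prop

/-- A Gaussian function on `ℂⁿ` with diagonal quadratic part. -/
def gaussian (b : Fin n → ℝ) (a c z : PhaseSpace n) : ℂ :=
  Complex.exp (-((∑ j, b j * ‖z j‖ ^ 2 : ℝ) : ℂ) + inner ℂ z a + inner ℂ c z)

theorem gaussian_ofReals (b : Fin n → ℝ) (a c : PhaseSpace n) (x : Fin n ⊕ Fin n → ℝ) :
    gaussian b a c (ofReals x) = Complex.exp
      (-∑ i, ((Sum.elim b b i : ℝ) : ℂ) * (x i : ℂ) ^ 2 +
        ∑ i, Sum.elim (fun j => a j + conj (c j)) (fun j => Complex.I * (conj (c j) - a j)) i *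
          (x i : ℂ)) := by
  rw [gaussian]
  congr 1
  simp only [Fintype.sum_sum_type, Sum.elim_inl, Sum.elim_inr, PiLp.inner_apply,
    RCLike.inner_apply, ofReals, Complex.ofReal_sum, ← Finset.sum_add_distrib,
    ← Finset.sum_neg_distrib]
  refine Finset.sum_congr rfl fun j _ => ?_
  have h : ((‖(x (Sum.inl j) : ℂ) + Complex.I * (x (Sum.inr j) : ℂ)‖ ^ 2 : ℝ) : ℂ) =
      (x (Sum.inl j) : ℂ) ^ 2 + (x (Sum.inr j) : ℂ) ^ 2 := by
    rw [mul_comm Complex.I, ← Complex.normSq_eq_norm_sq, Complex.normSq_add_mul_I]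
    push_cast
    rfl
  rw [Complex.ofReal_mul, h]
  simp only [map_add, map_mul, Complex.conj_I, Complex.conj_ofReal]
  ring

theorem integrable_gaussian {b : Fin n → ℝ} (hb : ∀ j, 0 < b j) (a c : PhaseSpace n) :
    Integrable fun x : Fin n ⊕ Fin n → ℝ => gaussian b a c (ofReals x) := by
  simp only [gaussian_ofReals]
  refine GaussianFourier.integrable_cexp_neg_sum_mul_add
    (b := fun i => ((Sum.elim b b i : ℝ) : ℂ)) (fun i => ?_) _
  rcases i with i | i <;> simpa using hb i

/-- The integral splits into `2n` real Gaussians; the two belonging to one mode are recombined. -/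
theorem integral_gaussian_ofReals {b : Fin n → ℝ} (hb : ∀ j, 0 < b j) (a c : PhaseSpace n) :
    ∫ x : Fin n ⊕ Fin n → ℝ, gaussian b a c (ofReals x) =
      ∏ j, ((Real.pi / b j : ℝ) : ℂ) * Complex.exp (conj (c j) * a j / b j) := by
  simp only [gaussian_ofReals]
  rw [GaussianFourier.integral_cexp_neg_sum_mul_add
    (b := fun i => ((Sum.elim b b i : ℝ) : ℂ))
    (by rintro (i | i) <;> simpa using hb i), Fintype.prod_sum_type, ← Finset.prod_mul_distrib]
  refine Finset.prod_congr rfl fun j _ => ?_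
  simp only [Sum.elim_inl, Sum.elim_inr]
  have hbj : (b j : ℂ) ≠ 0 := by simpa using (hb j).ne'
  have hp : (Real.pi / b j : ℂ) ≠ 0 :=
    div_ne_zero (Complex.ofReal_ne_zero.2 Real.pi_ne_zero) hbj
  rw [mul_mul_mul_comm, ← Complex.cpow_add _ _ hp, ← Complex.exp_add, add_halves,
    Complex.cpow_one, Complex.ofReal_div]
  congr 2
  -- The linear coefficients are `a + c̄` and `i(c̄ - a)`, and `(a + c̄)² - (c̄ - a)² = 4ac̄`.
  rw [mul_pow, Complex.I_sq]
  field_simp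
  ring

/-- The function `z ↦ ⟨e(w)| W(z)† |e(v)⟩`. -/
def weylKernel (v w z : PhaseSpace n) : ℂ :=
  Complex.exp (inner ℂ w v) * gaussian (fun _ => 1 / 2) v (-w) z

theorem integrable_weylKernel (v w : PhaseSpace n) :
    Integrable fun x : Fin n ⊕ Fin n → ℝ => weylKernel v w (ofReals x) :=
  (integrable_gaussian (fun _ => by norm_num) _ _).const_mul _

theorem inner_expVec_weyl_expVec (v w z : PhaseSpace n) :
    inner ℂ (expVec v) (weyl z (expVec w)) =
      Complex.exp (inner ℂ v w) * gaussian (fun _ => 1 / 2) (-w) v z := by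
  rw [weyl_expVec, inner_smul_right, inner_expVec, gaussian, ← Complex.exp_add,
    ← Complex.exp_add, inner_add_right, inner_neg_right, EuclideanSpace.norm_sq_eq,
    ← Finset.mul_sum]
  congr 1
  push_cast
  ring

theorem gaussian_mul_gaussian (b b' : Fin n → ℝ) (a c a' c' z : PhaseSpace n) :
    gaussian b a c z * gaussian b' a' c' z = gaussian (b + b') (a + a') (c + c') z := by
  rw [gaussian, gaussian, gaussian, ← Complex.exp_add, inner_add_left, inner_add_right]
  congr 1
  simp only [Pi.add_apply, add_mul, Finset.sum_add_distrib]
  push_cast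
  ring

/-- Orthogonality of Weyl matrix elements: the two Gaussians of width parameter `1/2` multiply to
one of parameter `1`, whose integral contributes `π` per mode. -/
theorem integral_weylKernel_mul_inner (v w x y : PhaseSpace n) :
    ∫ t : Fin n ⊕ Fin n → ℝ, weylKernel v w (ofReals t) *
        inner ℂ (expVec x) (weyl (ofReals t) (expVec y)) =
      (Real.pi : ℂ) ^ n * (inner ℂ (expVec x) (expVec v) * inner ℂ (expVec w) (expVec y)) := by
  have h : ∀ z : PhaseSpace n, weylKernel v w z * inner ℂ (expVec x) (weyl z (expVec y)) =
      Complex.exp (inner ℂ w v + inner ℂ x y) *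
        gaussian (fun _ => 1) (v + -y) (-w + x) z := fun z => by
    rw [inner_expVec_weyl_expVec, weylKernel, mul_mul_mul_comm, gaussian_mul_gaussian,
      Complex.exp_add]
    congr 2
    funext j
    norm_num
  simp only [h]
  rw [integral_const_mul, integral_gaussian_ofReals fun _ => one_pos, Finset.prod_mul_distrib,
    ← Complex.exp_sum, mul_left_comm, ← Complex.exp_add, inner_expVec, inner_expVec,
    ← Complex.exp_add]
  congr 1
  · simp
  · have h2 : ∑ j, conj ((-w + x) j) * (v + -y) j / ((1 : ℝ) : ℂ) =
        inner ℂ (-w + x) (v + -y) := by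
      rw [PiLp.inner_apply]
      refine Finset.sum_congr rfl fun j _ => ?_
      rw [Complex.ofReal_one, div_one, mul_comm]
      rfl
    rw [h2, inner_add_left, inner_add_right, inner_add_right, inner_neg_left, inner_neg_left,
      inner_neg_right, inner_neg_right]
    congr 1
    ring

/-! ### Matrix elements of a state from its characteristic function -/

theorem continuous_weylKernel (v w : PhaseSpace n) : Continuous (weylKernel v w) := by
  unfold weylKernel gaussian
  fun_prop

theorem integrable_weylKernel_smul_weyl (v w : PhaseSpace n) (y : Fock n) :
    Integrable fun t : Fin n ⊕ Fin n → ℝ =>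
      weylKernel v w (ofReals t) • weyl (ofReals t) y := by
  refine Integrable.mono' ((integrable_weylKernel v w).norm.mul_const ‖y‖) ?_ ?_
  · have h1 := (continuous_weylKernel v w).comp continuous_ofReals
    have h2 := (continuous_weyl_apply y).comp continuous_ofReals
    exact (h1.smul h2).aestronglyMeasurable
  · exact Filter.Eventually.of_forall fun t => by rw [norm_smul, norm_weyl_apply]

/-- The operator `∫ ⟨e(w)| W(z)† |e(v)⟩ W(z) dz`. -/
def weylIntegral (v w : PhaseSpace n) : Fock n →L[ℂ] Fock n :=
  LinearMap.mkContinuous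
    { toFun := fun y => ∫ t : Fin n ⊕ Fin n → ℝ,
        weylKernel v w (ofReals t) • weyl (ofReals t) y
      map_add' := fun x y => by
        rw [← integral_add (integrable_weylKernel_smul_weyl v w x)
          (integrable_weylKernel_smul_weyl v w y)]
        simp only [map_add, smul_add]
      map_smul' := fun a x => by
        rw [RingHom.id_apply, ← integral_smul]
        simp only [map_smul, smul_comm a] }
    (∫ t : Fin n ⊕ Fin n → ℝ, ‖weylKernel v w (ofReals t)‖) fun y => by
      refine (norm_integral_le_integral_norm _).trans_eq ?_
      simp only [norm_smul, norm_weyl_apply, integral_mul_const]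

theorem inner_weylIntegral (v w : PhaseSpace n) (x y : Fock n) :
    inner ℂ x (weylIntegral v w y) = ∫ t : Fin n ⊕ Fin n → ℝ,
      weylKernel v w (ofReals t) * inner ℂ x (weyl (ofReals t) y) := by
  change inner ℂ x (∫ t : Fin n ⊕ Fin n → ℝ,
    weylKernel v w (ofReals t) • weyl (ofReals t) y) = _
  rw [← integral_inner (integrable_weylKernel_smul_weyl v w y)]
  simp only [inner_smul_right]

/-- The rank-one operator `πⁿ |e(v)⟩⟨e(w)|` is thus a superposition of Weyl operators; orthogonality
identifies the two on exponential vectors, which are total. -/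
theorem weylIntegral_apply (v w : PhaseSpace n) (y : Fock n) :
    weylIntegral v w y = ((Real.pi : ℂ) ^ n * inner ℂ (expVec w) y) • expVec v := by
  have h : weylIntegral v w =
      (Real.pi : ℂ) ^ n • (innerSL ℂ (expVec w)).smulRight (expVec v) := by
    refine ext_inner_expVec_expVec fun x y => ?_
    rw [inner_weylIntegral, integral_weylKernel_mul_inner]
    simp only [smul_apply, ContinuousLinearMap.smulRight_apply, innerSL_apply_apply,
      inner_smul_right]
    ring
  rw [h, smul_apply, ContinuousLinearMap.smulRight_apply, innerSL_apply_apply, smul_smul]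

/-- Fourier–Weyl inversion, the trace of `ρ` against the rank-one operator above. The trace is
summed through `ρ = K K†`, where Fubini applies because the integrals of norms are bounded by a
multiple of `‖K|β⟩‖²`. -/
theorem IsState.integral_weylKernel_mul_charFn {ρ : Fock n →L[ℂ] Fock n} (h : IsState ρ)
    (v w : PhaseSpace n) :
    ∫ t : Fin n ⊕ Fin n → ℝ, weylKernel v w (ofReals t) * charFn ρ (ofReals t) =
      (Real.pi : ℂ) ^ n * inner ℂ (expVec w) (ρ (expVec v)) := by
  obtain ⟨K, hK, rfl⟩ := h.exists_factor
  have h1 : ∀ β : Fin n → ℕ, Integrable fun t : Fin n ⊕ Fin n → ℝ =>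
      weylKernel v w (ofReals t) *
        inner ℂ (K (numberVec β)) (weyl (ofReals t) (K (numberVec β))) := fun β => by
    have := (integrable_weylKernel_smul_weyl v w (K (numberVec β))).const_inner (𝕜 := ℂ)
      (K (numberVec β))
    simpa only [inner_smul_right] using this
  have h2 : Summable fun β : Fin n → ℕ => ∫ t : Fin n ⊕ Fin n → ℝ,
      ‖weylKernel v w (ofReals t) *
        inner ℂ (K (numberVec β)) (weyl (ofReals t) (K (numberVec β)))‖ := by
    refine Summable.of_nonneg_of_le (fun β => integral_nonneg fun _ => norm_nonneg _)
      (fun β => ?_) (hK.mul_left (∫ t : Fin n ⊕ Fin n → ℝ, ‖weylKernel v w (ofReals t)‖))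
    rw [← integral_mul_const]
    refine integral_mono (h1 β).norm ((integrable_weylKernel v w).norm.mul_const _) fun t => ?_
    rw [norm_mul, sq]
    refine mul_le_mul_of_nonneg_left ((norm_inner_le_norm _ _).trans_eq ?_) (norm_nonneg _)
    rw [norm_weyl_apply]
  have h3 := hasSum_integral_of_summable_integral_norm h1 h2
  simp only [charFn, hK.trace_comp, ← tsum_mul_left]
  refine h3.unique ?_
  simp only [← inner_weylIntegral, weylIntegral_apply, inner_smul_right, mul_assoc]
  refine HasSum.mul_left _ ?_
  rw [ContinuousLinearMap.comp_apply, ← ContinuousLinearMap.adjoint_inner_left]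
  refine ((numberBasis n).hasSum_inner_mul_inner _ _).congr_fun fun β => ?_
  rw [numberBasis_apply, ContinuousLinearMap.adjoint_inner_left,
    ContinuousLinearMap.adjoint_inner_right]

/-! ### Centered gauge-invariant Gaussian states -/

theorem IsState.inner_expVec_of_charFn {ρ : Fock n →L[ℂ] Fock n} (h : IsState ρ)
    {d : Fin n → ℝ} (hd : ∀ j, 0 ≤ d j)
    (hc : ∀ z, charFn ρ z = Complex.exp (-((∑ j, d j * ‖z j‖ ^ 2 : ℝ) : ℂ)))
    (w v : PhaseSpace n) :
    inner ℂ (expVec w) (ρ (expVec v)) =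
      ∏ j, ((1 / (d j + 1 / 2) : ℝ) : ℂ) *
        Complex.exp (((1 - 1 / (d j + 1 / 2) : ℝ) : ℂ) * (conj (w j) * v j)) := by
  have hpi : (Real.pi : ℂ) ^ n ≠ 0 := pow_ne_zero _ (Complex.ofReal_ne_zero.2 Real.pi_ne_zero)
  refine mul_left_cancel₀ hpi ?_
  have h1 : ∀ z : PhaseSpace n, weylKernel v w z * charFn ρ z =
      Complex.exp (inner ℂ w v) * gaussian (fun j => d j + 1 / 2) v (-w) z := fun z => by
    rw [hc, weylKernel, gaussian, gaussian, mul_assoc, ← Complex.exp_add]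
    congr 2
    simp only [add_mul, Finset.sum_add_distrib]
    push_cast
    ring
  rw [← h.integral_weylKernel_mul_charFn v w]
  simp only [h1]
  rw [integral_const_mul, integral_gaussian_ofReals fun j => by linarith [hd j],
    PiLp.inner_apply, Complex.exp_sum, ← Finset.prod_mul_distrib]
  have h2 : (Real.pi : ℂ) ^ n = ∏ _j : Fin n, (Real.pi : ℂ) := by simp
  rw [h2, ← Finset.prod_mul_distrib]
  refine Finset.prod_congr rfl fun j _ => ?_
  have h3 : (inner ℂ (w j) (v j) : ℂ) = conj (w j) * v j := mul_comm _ _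
  rw [h3, mul_left_comm, ← Complex.exp_add, ← mul_assoc]
  congr 2
  · push_cast
    ring
  · simp only [PiLp.neg_apply, map_neg]
    push_cast
    ring

/-- The uncertainty principle, extracted from positivity of `ρ` on a single vector in mode `j`. -/
theorem IsState.half_le_of_charFn {ρ : Fock n →L[ℂ] Fock n} (h : IsState ρ) {d : Fin n → ℝ}
    (hd : ∀ j, 0 ≤ d j)
    (hc : ∀ z, charFn ρ z = Complex.exp (-((∑ j, d j * ‖z j‖ ^ 2 : ℝ) : ℂ))) (j : Fin n) :
    1 / 2 ≤ d j := by
  set q : ℝ := 1 - 1 / (d j + 1 / 2) with hq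
  set C : ℝ := ∏ j, (1 / (d j + 1 / 2)) with hC
  have hC0 : 0 < C := Finset.prod_pos fun j _ => by have := hd j; positivity
  have key : ∀ a b : ℝ, inner ℂ (expVec (EuclideanSpace.single j (a : ℂ)))
      (ρ (expVec (EuclideanSpace.single j (b : ℂ)))) = ((C * Real.exp (q * (a * b)) : ℝ) : ℂ) := by
    intro a b
    rw [h.inner_expVec_of_charFn hd hc, Finset.prod_mul_distrib, ← Complex.exp_sum,
      Finset.sum_eq_single j]
    · simp [hC, hq]
    · intro i _ hi
      simp [hi]
    · simp
  -- On this odd vector the expectation is `2C(e^q - e^{-q})`, whose sign is that of `q`.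
  have hpos := h.1.re_inner_nonneg_right (expVec (EuclideanSpace.single j ((1 : ℝ) : ℂ)) -
    expVec (EuclideanSpace.single j ((-1 : ℝ) : ℂ)))
  rw [map_sub, inner_sub_left, inner_sub_right, inner_sub_right, key, key, key, key,
    ← Complex.ofReal_sub, ← Complex.ofReal_sub, ← Complex.ofReal_sub, RCLike.re_to_complex,
    Complex.ofReal_re] at hpos
  have h1 : Real.exp (-q) ≤ Real.exp q := by
    norm_num at hpos
    nlinarith
  have h2 : 0 ≤ q := by
    have := Real.exp_le_exp.1 h1
    linarith
  have h3 : 0 < d j + 1 / 2 := by linarith [hd j]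
  rw [hq, sub_nonneg, div_le_one h3] at h2
  linarith

/-! ### Thermal states -/

theorem thermal_apply (s : Fin n → ℝ≥0∞) (x : Fock n) (α : Fin n → ℕ) :
    thermal s x α = ((∏ j, thermalWeight (s j) (α j) : ℝ) : ℂ) * x α := by
  rw [thermal, lp.mapCLM_apply_coe]
  rfl

/-- The sum over occupation numbers factors into one exponential series per mode, with the Boltzmann
factor absorbed into its argument. -/
theorem inner_expVec_thermal_expVec (s : Fin n → ℝ≥0∞) (w v : PhaseSpace n) :
    inner ℂ (expVec w) (thermal s (expVec v)) =
      ∏ j, ((1 - boltzmann (s j) : ℝ) : ℂ) *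
        Complex.exp ((boltzmann (s j) : ℂ) * (conj (w j) * v j)) := by
  have h := hasSum_pi_prod (fun j k =>
    ((boltzmann (s j) : ℂ) * (conj (w j) * v j)) ^ k / (k ! : ℂ)) fun j => summable_norm_expSeries _
  have h0 := h.mul_left (∏ j, ((1 - boltzmann (s j) : ℝ) : ℂ))
  have h1 := lp.hasSum_inner (𝕜 := ℂ) (expVec w) (thermal s (expVec v))
  have h2 : (fun α : Fin n → ℕ => inner ℂ (expVec w α) (thermal s (expVec v) α)) =
      fun α => (∏ j, ((1 - boltzmann (s j) : ℝ) : ℂ)) *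
        ∏ j, ((boltzmann (s j) : ℂ) * (conj (w j) * v j)) ^ α j / ((α j)! : ℂ) := by
    funext α
    have h3 : inner ℂ (expVec w α) (thermal s (expVec v) α) =
        ((∏ j, thermalWeight (s j) (α j) : ℝ) : ℂ) * (conj (expCoeff w α) * expCoeff v α) := by
      rw [thermal_apply, RCLike.inner_apply, mul_assoc, mul_comm (conj _)]
      rfl
    rw [h3, conj_expCoeff_mul, Complex.ofReal_prod, ← Finset.prod_mul_distrib,
      ← Finset.prod_mul_distrib]
    refine Finset.prod_congr rfl fun j _ => ?_
    rw [thermalWeight, mul_pow (boltzmann (s j) : ℂ)]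
    push_cast
    ring
  rw [h2] at h1
  rw [h1.unique h0, Finset.prod_mul_distrib]
  congr 1
  refine Finset.prod_congr rfl fun j _ => ?_
  rw [Complex.exp_eq_exp_ℂ, NormedSpace.exp_eq_tsum_div]

/-- Take `s = -log q`; the endpoint `q = 0`, the vacuum, needs `s = ∞`. -/
theorem exists_boltzmann_eq {q : ℝ} (h0 : 0 ≤ q) (h1 : q < 1) :
    ∃ s : ℝ≥0∞, 0 < s ∧ boltzmann s = q := by
  rcases h0.eq_or_lt with rfl | h0
  · exact ⟨∞, ENNReal.zero_lt_top, if_pos rfl⟩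
  · have h2 : 0 < -Real.log q := neg_pos.2 (Real.log_neg h0 h1)
    refine ⟨ENNReal.ofReal (-Real.log q), ENNReal.ofReal_pos.2 h2, ?_⟩
    rw [boltzmann, if_neg ENNReal.ofReal_ne_top, ENNReal.toReal_ofReal h2.le, neg_neg,
      Real.exp_log h0]

theorem IsState.exists_eq_thermal {ρ : Fock n →L[ℂ] Fock n} (h : IsState ρ) {d : Fin n → ℝ}
    (hd : ∀ j, 1 / 2 ≤ d j)
    (hc : ∀ z, charFn ρ z = Complex.exp (-((∑ j, d j * ‖z j‖ ^ 2 : ℝ) : ℂ))) :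
    ∃ s : Fin n → ℝ≥0∞, (∀ j, 0 < s j) ∧ ρ = thermal s := by
  have hs : ∀ j, ∃ s : ℝ≥0∞, 0 < s ∧ boltzmann s = 1 - 1 / (d j + 1 / 2) := fun j => by
    have h1 : 0 < d j + 1 / 2 := by linarith [hd j]
    refine exists_boltzmann_eq ?_ ?_
    · rw [sub_nonneg, div_le_one h1]
      linarith [hd j]
    · exact sub_lt_self _ (by positivity)
  choose s hs0 hs using hs
  refine ⟨s, hs0, ext_inner_expVec_expVec fun w v => ?_⟩
  rw [h.inner_expVec_of_charFn (fun j => by linarith [hd j]) hc, inner_expVec_thermal_expVec]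
  simp only [hs, sub_sub_cancel]

/-- Multiplication by `i` as a unitary matrix. -/
def unitaryI (n : ℕ) : Matrix.unitaryGroup (Fin n) ℂ :=
  ⟨Complex.I • 1, by
    rw [Matrix.mem_unitaryGroup_iff, star_smul, star_one, smul_mul_smul_comm, mul_one]
    simp⟩

theorem toEuclideanLin_inv_unitaryI (v : PhaseSpace n) :
    Matrix.toEuclideanLin (((unitaryI n)⁻¹ : Matrix.unitaryGroup (Fin n) ℂ) :
      Matrix (Fin n) (Fin n) ℂ) v = -Complex.I • v := by
  ext j
  simp [unitaryI]

/-- Gauge invariance: the thermal matrix elements depend only on the products `w̄ⱼvⱼ`, in which a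
common phase cancels. -/
theorem passive_unitaryI_conj_thermal (s : Fin n → ℝ≥0∞) :
    passive (unitaryI n) ∘L thermal s ∘L (passive (unitaryI n)).adjoint = thermal s := by
  refine ext_inner_expVec_expVec fun w v => ?_
  simp only [ContinuousLinearMap.comp_apply]
  rw [← ContinuousLinearMap.adjoint_inner_left, adjoint_passive, passive_expVec, passive_expVec,
    inner_expVec_thermal_expVec, inner_expVec_thermal_expVec]
  refine Finset.prod_congr rfl fun j _ => ?_
  rw [toEuclideanLin_inv_unitaryI, toEuclideanLin_inv_unitaryI]
  congr 3
  simp only [PiLp.smul_apply, smul_eq_mul, map_mul, map_neg, Complex.conj_I]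
  linear_combination (-(conj (w j) * v j)) * Complex.I_mul_I

theorem charFn_thermal_smul_I {s : Fin n → ℝ≥0∞} (h : IsState (thermal s)) (z : PhaseSpace n) :
    charFn (thermal s) (Complex.I • z) = charFn (thermal s) z := by
  conv_lhs => rw [← passive_unitaryI_conj_thermal]
  rw [h.charFn_conj_passive, toEuclideanLin_inv_unitaryI, smul_smul]
  simp

/-! ### Complex linear covariance operators -/

theorem toEuclideanLin_mul_apply (A B : Matrix (Fin n) (Fin n) ℂ) (v : PhaseSpace n) :
    Matrix.toEuclideanLin (A * B) v = Matrix.toEuclideanLin A (Matrix.toEuclideanLin B v) := by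
  ext1
  simp [Matrix.mulVec_mulVec]

theorem single_eq_smul_add_smul (j : Fin n) (a : ℂ) :
    (EuclideanSpace.single j a : PhaseSpace n) =
      a.re • EuclideanSpace.single j (1 : ℂ) + a.im • EuclideanSpace.single j Complex.I := by
  ext i
  rcases eq_or_ne i j with rfl | hij
  · simp [Complex.re_add_im]
  · simp [hij]

theorem ext_single {S T : PhaseSpace n →ₗ[ℝ] PhaseSpace n}
    (h1 : ∀ j, S (EuclideanSpace.single j 1) = T (EuclideanSpace.single j 1))
    (hI : ∀ j, S (EuclideanSpace.single j Complex.I) = T (EuclideanSpace.single j Complex.I)) :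
    S = T := by
  ext1 v
  have hv : v = ∑ j, EuclideanSpace.single j (v j) := by
    ext i
    simp [Finset.sum_apply, Pi.single_apply]
  rw [hv, map_sum, map_sum]
  refine Finset.sum_congr rfl fun j _ => ?_
  rw [single_eq_smul_add_smul, map_add, map_add, map_smul, map_smul, map_smul, map_smul, h1, hI]

theorem toEuclideanLin_single (X : Matrix (Fin n) (Fin n) ℂ) (i j : Fin n) (a : ℂ) :
    Matrix.toEuclideanLin X (EuclideanSpace.single j a) i = X i j * a := by
  simp [Matrix.mulVec_single, mul_comm]

theorem realMatrix_eq_iff (S : PhaseSpace n →ₗ[ℝ] PhaseSpace n) (X : Matrix (Fin n) (Fin n) ℂ) :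
    realMatrix S = Matrix.fromBlocks (X.map Complex.re) (-(X.map Complex.im))
        (X.map Complex.im) (X.map Complex.re) ↔
      ∀ v, S v = Matrix.toEuclideanLin X v := by
  rw [realMatrix, Matrix.fromBlocks_inj]
  constructor
  · rintro ⟨h1, h2, h3, h4⟩ v
    have h : S = (Matrix.toEuclideanLin X).restrictScalars ℝ := by
      refine ext_single (fun j => ?_) fun j => ?_ <;> ext i <;>
        rw [LinearMap.restrictScalars_apply, toEuclideanLin_single]
      · refine Complex.ext ?_ ?_
        · simpa using congrFun (congrFun h1 i) j
        · simpa using congrFun (congrFun h3 i) j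
      · refine Complex.ext ?_ ?_
        · simpa using congrFun (congrFun h2 i) j
        · simpa using congrFun (congrFun h4 i) j
    rw [h, LinearMap.restrictScalars_apply]
  · intro h
    refine ⟨?_, ?_, ?_, ?_⟩ <;> ext i j <;>
      simp only [Matrix.of_apply, Matrix.map_apply, Matrix.neg_apply, h, toEuclideanLin_single] <;>
      simp

/-- Comparing blocks, commutation with `J` leaves the shape `[[A, -B], [B, A]]`, the real form of `A
+ iB`. -/
theorem realMatrix_commute_iff (S : PhaseSpace n →ₗ[ℝ] PhaseSpace n) :
    realMatrix S * stdJ n = stdJ n * realMatrix S ↔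
      ∃ X : Matrix (Fin n) (Fin n) ℂ, ∀ v, S v = Matrix.toEuclideanLin X v := by
  constructor
  · intro h
    rw [realMatrix, stdJ, Matrix.fromBlocks_multiply, Matrix.fromBlocks_multiply,
      Matrix.fromBlocks_inj] at h
    simp only [mul_zero, zero_add, mul_neg, mul_one, add_zero, zero_mul, one_mul, neg_mul] at h
    obtain ⟨h1, h2, -, -⟩ := h
    refine ⟨Matrix.of fun i j => S (EuclideanSpace.single j 1) i, (realMatrix_eq_iff S _).1 ?_⟩
    rw [realMatrix, Matrix.fromBlocks_inj]
    refine ⟨rfl, ?_, rfl, h2.symm⟩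
    rw [← neg_neg (Matrix.of fun i j => (S (EuclideanSpace.single j Complex.I) i).re), h1]
    rfl
  · rintro ⟨X, hX⟩
    rw [(realMatrix_eq_iff S X).2 hX, stdJ, Matrix.fromBlocks_multiply, Matrix.fromBlocks_multiply]
    simp

theorem exists_toEuclideanLin_of_map_smul_I {S : PhaseSpace n →ₗ[ℝ] PhaseSpace n}
    (h : ∀ v, S (Complex.I • v) = Complex.I • S v) :
    ∃ X : Matrix (Fin n) (Fin n) ℂ, ∀ v, S v = Matrix.toEuclideanLin X v := by
  have hs : ∀ j, (EuclideanSpace.single j Complex.I : PhaseSpace n) =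
      Complex.I • EuclideanSpace.single j 1 := fun j => by
    ext i
    simp
  refine ⟨Matrix.of fun i j => S (EuclideanSpace.single j 1) i, (realMatrix_eq_iff S _).1 ?_⟩
  rw [realMatrix, Matrix.fromBlocks_inj]
  refine ⟨rfl, ?_, rfl, ?_⟩ <;> ext i j <;> simp [hs, h]

/-- Polarization turns invariance of the quadratic form under `i` into invariance of the symmetric
bilinear form, which is nondegenerate enough to read off `S`. -/
theorem map_smul_I_of_form {S : PhaseSpace n →ₗ[ℝ] PhaseSpace n}
    (hS : ∀ u v : PhaseSpace n, (inner ℂ u (S v)).re = (inner ℂ (S u) v).re)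
    (h : ∀ v, (inner ℂ (Complex.I • v) (S (Complex.I • v))).re = (inner ℂ v (S v)).re)
    (v : PhaseSpace n) : S (Complex.I • v) = Complex.I • S v := by
  have hsymm : ∀ u v : PhaseSpace n, (inner ℂ u (S v)).re = (inner ℂ v (S u)).re := fun u v => by
    rw [hS, ← inner_conj_symm, Complex.conj_re]
  have hpol : ∀ u v : PhaseSpace n,
      (inner ℂ (Complex.I • u) (S (Complex.I • v))).re = (inner ℂ u (S v)).re := fun u v => by
    have h1 := h (u + v)
    simp only [smul_add, map_add, inner_add_left, inner_add_right, Complex.add_re] at h1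
    linarith [h u, h v, hsymm u v, hsymm (Complex.I • u) (Complex.I • v)]
  have h2 : ∀ u : PhaseSpace n,
      (inner ℂ (Complex.I • u) (S (Complex.I • v) - Complex.I • S v)).re = 0 := fun u => by
    rw [inner_sub_right, Complex.sub_re, hpol, sub_eq_zero, inner_smul_left, inner_smul_right,
      ← mul_assoc]
    simp
  -- With this choice `i u` is the defect `S(iv) - iSv` itself, so its squared norm vanishes.
  have h3 := h2 (-Complex.I • (S (Complex.I • v) - Complex.I • S v))
  rw [smul_smul, mul_neg, Complex.I_mul_I, neg_neg, one_smul] at h3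
  exact sub_eq_zero.1 (inner_self_eq_zero.1 (Complex.ext h3 (inner_self_im (𝕜 := ℂ) _)))

theorem isHermitian_of_symmetric {X : Matrix (Fin n) (Fin n) ℂ}
    (h : ∀ u v : PhaseSpace n, (inner ℂ u (Matrix.toEuclideanLin X v)).re =
      (inner ℂ (Matrix.toEuclideanLin X u) v).re) : X.IsHermitian := by
  rw [← Matrix.isSymmetric_toEuclideanLin_iff]
  intro u v
  refine Complex.ext (h u v).symm ?_
  -- Replacing `v` by `iv` turns the identity of real parts into one of imaginary parts.
  have h1 := h u (Complex.I • v)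
  rw [map_smul, inner_smul_right, inner_smul_right] at h1
  simpa using h1.symm

/-! ### Gauge-invariant Gaussian states -/

theorem weyl_conj_weyl_neg (u : PhaseSpace n) (T : Fock n →L[ℂ] Fock n) :
    weyl u ∘L (weyl (-u) ∘L T ∘L (weyl (-u)).adjoint) ∘L (weyl u).adjoint = T := by
  have h := weyl_comp_adjoint_weyl u
  calc _ = (weyl u ∘L (weyl u).adjoint) ∘L T ∘L (weyl u ∘L (weyl u).adjoint) := by
        rw [← adjoint_weyl, ContinuousLinearMap.adjoint_adjoint]
        simp only [ContinuousLinearMap.comp_assoc]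
    _ = T := by rw [h, ContinuousLinearMap.comp_id, ContinuousLinearMap.id_comp]

theorem IsGaussian.norm_charFn {ρ : Fock n →L[ℂ] Fock n} {m : PhaseSpace n}
    {S : PhaseSpace n →ₗ[ℝ] PhaseSpace n} (h : IsGaussian ρ m S) (z : PhaseSpace n) :
    ‖charFn ρ z‖ = Real.exp (-(inner ℂ z (S z)).re) := by
  rw [h.charFn_eq, Complex.norm_exp]
  simp

theorem IsGaussian.map_smul_I {ρ : Fock n →L[ℂ] Fock n} {m : PhaseSpace n}
    {S : PhaseSpace n →ₗ[ℝ] PhaseSpace n} (h : IsGaussian ρ m S)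
    {U : Matrix.unitaryGroup (Fin n) ℂ}
    (hU : IsDisplacedThermal (passive U ∘L ρ ∘L (passive U).adjoint)) (v : PhaseSpace n) :
    S (Complex.I • v) = Complex.I • S v := by
  obtain ⟨u, s, -, hρ⟩ := hU
  have hst := h.isState.conj (adjoint_passive_comp_passive U)
  have hth : thermal s = weyl (-u) ∘L (passive U ∘L ρ ∘L (passive U).adjoint) ∘L
      (weyl (-u)).adjoint := by
    have h1 := weyl_conj_weyl_neg (-u) (thermal s)
    rw [neg_neg] at h1
    rw [hρ, h1]
  -- The thermal operator is a unitary conjugate of `ρ`, so it inherits the state property without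
  -- summing its weights.
  have hsth : IsState (thermal s) := by
    rw [hth]
    exact hst.conj (adjoint_weyl_comp_weyl _)
  -- Taking absolute values removes the phase due to the displacement.
  have hn : ∀ z, ‖charFn ρ z‖ = ‖charFn (thermal s)
      (Matrix.toEuclideanLin (U : Matrix (Fin n) (Fin n) ℂ) z)‖ := fun z => by
    have h1 := h.isState.charFn_conj_passive U
      (Matrix.toEuclideanLin (U : Matrix (Fin n) (Fin n) ℂ) z)
    rw [← toEuclideanLin_mul_apply, ← Matrix.UnitaryGroup.mul_val, inv_mul_cancel, hρ,
      hsth.charFn_conj_weyl] at h1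
    have h2 : Matrix.toEuclideanLin ((1 : Matrix.unitaryGroup (Fin n) ℂ) :
        Matrix (Fin n) (Fin n) ℂ) z = z := by ext1; simp
    rw [h2] at h1
    rw [← h1, norm_mul, Complex.norm_exp]
    simp
  refine map_smul_I_of_form h.symmetric (fun v => ?_) v
  have h3 := hn (Complex.I • v)
  rw [map_smul, charFn_thermal_smul_I hsth, ← hn, h.norm_charFn, h.norm_charFn,
    Real.exp_eq_exp, neg_inj] at h3
  exact h3

theorem IsGaussian.diagonalization {ρ : Fock n →L[ℂ] Fock n} {m : PhaseSpace n}
    {S : PhaseSpace n →ₗ[ℝ] PhaseSpace n} (h : IsGaussian ρ m S)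
    {X : Matrix (Fin n) (Fin n) ℂ} (hX : ∀ v, S v = Matrix.toEuclideanLin X v) :
    (X - (1 / 2 : ℂ) • (1 : Matrix (Fin n) (Fin n) ℂ)).PosSemidef ∧
      ∃ U : Matrix.unitaryGroup (Fin n) ℂ,
        IsDisplacedThermal (passive U ∘L ρ ∘L (passive U).adjoint) := by
  have hH : X.IsHermitian := isHermitian_of_symmetric fun u v => by
    rw [← hX, ← hX, h.symmetric]
  set V : Matrix.unitaryGroup (Fin n) ℂ := hH.eigenvectorUnitary
  set d : Fin n → ℝ := hH.eigenvalues
  have hspec : X = (V : Matrix (Fin n) (Fin n) ℂ) * Matrix.diagonal (fun j => (d j : ℂ)) *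
      star (V : Matrix (Fin n) (Fin n) ℂ) := by
    have h1 := hH.spectral_theorem
    rw [Unitary.conjStarAlgAut_apply] at h1
    exact h1
  have hVV : star (V : Matrix (Fin n) (Fin n) ℂ) * V = 1 := Matrix.UnitaryGroup.star_mul_self V
  have hVV' : (V : Matrix (Fin n) (Fin n) ℂ) * star (V : Matrix (Fin n) (Fin n) ℂ) = 1 :=
    Matrix.mem_unitaryGroup_iff.1 V.2
  have hquad : ∀ z, (inner ℂ (Matrix.toEuclideanLin (V : Matrix (Fin n) (Fin n) ℂ) z)
      (S (Matrix.toEuclideanLin (V : Matrix (Fin n) (Fin n) ℂ) z))).re =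
        ∑ j, d j * ‖z j‖ ^ 2 := fun z => by
    rw [hX, ← toEuclideanLin_mul_apply]
    conv_lhs => rw [hspec]
    rw [mul_assoc, hVV, mul_one, toEuclideanLin_mul_apply, inner_unitary, PiLp.inner_apply,
      Complex.re_sum]
    refine Finset.sum_congr rfl fun j _ => ?_
    have h1 : Matrix.toEuclideanLin (Matrix.diagonal fun j => (d j : ℂ)) z j = d j * z j := by
      simp [Matrix.mulVec_diagonal]
    rw [h1, RCLike.inner_apply, mul_assoc, Complex.mul_conj', Complex.re_ofReal_mul]
    norm_cast
  set u : PhaseSpace n := Matrix.toEuclideanLin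
    ((V⁻¹ : Matrix.unitaryGroup (Fin n) ℂ) : Matrix (Fin n) (Fin n) ℂ) m with hu
  have hVu : Matrix.toEuclideanLin (V : Matrix (Fin n) (Fin n) ℂ) u = m := by
    rw [hu, ← toEuclideanLin_mul_apply, Matrix.UnitaryGroup.inv_val, hVV']
    ext1
    simp
  -- Rotating by `V⁻¹` evaluates the characteristic function of `ρ` at `Vz`, which diagonalizes the
  -- form and moves the mean to `u = V⁻¹m`; displacing by `-u` then centers the state.
  set ρ' := passive V⁻¹ ∘L ρ ∘L (passive V⁻¹).adjoint with hρ'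
  have hst' : IsState ρ' := h.isState.conj (adjoint_passive_comp_passive _)
  have hc' : ∀ z, charFn ρ' z = Complex.exp (-2 * Complex.I * ((inner ℂ z u).im : ℂ) -
      ((∑ j, d j * ‖z j‖ ^ 2 : ℝ) : ℂ)) := fun z => by
    rw [h.isState.charFn_conj_passive, inv_inv, h.charFn_eq, hquad]
    conv_lhs => rw [← hVu]
    rw [inner_unitary]
  set ρ₀ := weyl (-u) ∘L ρ' ∘L (weyl (-u)).adjoint with hρ₀
  have hst₀ : IsState ρ₀ := hst'.conj (adjoint_weyl_comp_weyl _)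
  have hc₀ : ∀ z, charFn ρ₀ z = Complex.exp (-((∑ j, d j * ‖z j‖ ^ 2 : ℝ) : ℂ)) := fun z => by
    rw [hst'.charFn_conj_weyl, hc', ← Complex.exp_add, inner_neg_right, Complex.neg_im]
    congr 1
    push_cast
    ring
  -- The bound `|tr (ρ W(z))| ≤ 1` at `eⱼ` reads `e^{-dⱼ} ≤ 1`. This makes the inversion integral
  -- converge, after which positivity improves the bound to `1/2`.
  have hd0 : ∀ j, 0 ≤ d j := fun j => by
    have h1 := hst₀.norm_charFn_le_one (EuclideanSpace.single j 1)
    rw [hc₀, Finset.sum_eq_single j, Complex.norm_exp] at h1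
    · simpa using h1
    · intro i _ hi
      simp [hi]
    · simp
  have hd : ∀ j, 1 / 2 ≤ d j := hst₀.half_le_of_charFn hd0 hc₀
  constructor
  · have h1 : X - (1 / 2 : ℂ) • (1 : Matrix (Fin n) (Fin n) ℂ) =
        (V : Matrix (Fin n) (Fin n) ℂ) * Matrix.diagonal (fun j => ((d j - 1 / 2 : ℝ) : ℂ)) *
          (V : Matrix (Fin n) (Fin n) ℂ).conjTranspose := by
      have h2 : Matrix.diagonal (fun j => ((d j - 1 / 2 : ℝ) : ℂ)) =
          Matrix.diagonal (fun j => (d j : ℂ)) -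
            (1 / 2 : ℂ) • (1 : Matrix (Fin n) (Fin n) ℂ) := by
        rw [Matrix.smul_one_eq_diagonal, Matrix.diagonal_sub]
        push_cast
        rfl
      rw [h2, mul_sub, sub_mul, ← Matrix.star_eq_conjTranspose, ← hspec, mul_smul_comm, mul_one,
        smul_mul_assoc, hVV']
    rw [h1]
    refine Matrix.PosSemidef.mul_mul_conjTranspose_same
      (Matrix.posSemidef_diagonal_iff.2 fun j => ?_) _
    exact Complex.zero_le_real.2 (sub_nonneg.2 (hd j))
  · obtain ⟨s, hs, hth⟩ := hst₀.exists_eq_thermal hd hc₀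
    refine ⟨V⁻¹, u, s, hs, ?_⟩
    rw [← hth, hρ₀, weyl_conj_weyl_neg]

end Bosonic

end

theorem mainTheorem1 {n : ℕ} (ρ : Bosonic.Fock n →L[ℂ] Bosonic.Fock n) (m : Bosonic.PhaseSpace n)
    (S : Bosonic.PhaseSpace n →ₗ[ℝ] Bosonic.PhaseSpace n) (hρ : Bosonic.IsGaussian ρ m S) :
    ((∃ U : Matrix.unitaryGroup (Fin n) ℂ, Bosonic.IsDisplacedThermal
        (Bosonic.passive U ∘L ρ ∘L (Bosonic.passive U).adjoint)) ↔
      Bosonic.realMatrix S * Bosonic.stdJ n = Bosonic.stdJ n * Bosonic.realMatrix S) ∧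
    (Bosonic.realMatrix S * Bosonic.stdJ n = Bosonic.stdJ n * Bosonic.realMatrix S ↔
      ∃ X : Matrix (Fin n) (Fin n) ℂ,
        (X - (1 / 2 : ℂ) • (1 : Matrix (Fin n) (Fin n) ℂ)).PosSemidef ∧
        Bosonic.realMatrix S = Matrix.fromBlocks (X.map Complex.re) (-(X.map Complex.im))
          (X.map Complex.im) (X.map Complex.re)) := by
  rw [Bosonic.realMatrix_commute_iff]
  refine ⟨⟨fun ⟨U, hU⟩ => ?_, fun ⟨X, hX⟩ => (hρ.diagonalization hX).2⟩, fun ⟨X, hX⟩ => ?_,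
    fun ⟨X, _, hX⟩ => ⟨X, (Bosonic.realMatrix_eq_iff S X).1 hX⟩⟩
  · exact Bosonic.exists_toEuclideanLin_of_map_smul_I (hρ.map_smul_I hU)
  · exact ⟨X, (hρ.diagonalization hX).1, (Bosonic.realMatrix_eq_iff S X).2 hX⟩
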